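/- Let $\mu,\nu,\sigma,\tau>0$. For $k\ge 1$ let $$A(k)=\begin{pmatrix}\alpha_k&\beta_k\\ \gamma_k&\delta_k\end{pmatrix},$$ where all the random variables $\alpha_k,\beta_k,\gamma_k,\delta_k$ $(k\ge1)$ are mutually independent and $\alpha_k,\beta_k,\gamma_k,\delta_k$ are exponentially distributed with parameters (rates) $\mu,\nu,\sigma,\tau$ respectively. Let $x(0)=y(0)=0$ and, for $k\ge1$, $$x(k)=\max(x(k-1)+\alpha_k,\;y(k-1)+\beta_k),\qquad y(k)=\max(x(k-1)+\gamma_k,\;y(k-1)+\delta_k),$$ that is, $z(k)=A(k)z(k-1)$ in the max-plus semiring with $z(k)=(x(k),y(k))^T$. Define $$U_1=\begin{pmatrix}1&1&1\\ \frac{\mu}{\mu+\nu}&\frac12&\frac{\mu+\nu}{\mu+2\nu}\\ \frac{\mu}{\mu+\tau}&\frac{\nu}{\nu+\tau}&\frac{\mu+\nu}{\mu+\nu+\tau}\\ \frac{\mu}{\mu+\nu+\tau}&\frac{\nu}{2\nu+\tau}&\frac{\mu+\nu}{\mu+2\nu+\tau}\end{pmatrix},\qquad U_2=\begin{pmatrix}1&1&1\\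 \frac{\sigma}{\mu+\sigma}&\frac{\tau}{\mu+\tau}&\frac{\sigma+\tau}{\mu+\sigma+\tau}\\ \frac12&\frac{\tau}{\sigma+\tau}&\frac{\sigma+\tau}{2\sigma+\tau}\\ \frac{\sigma}{\mu+2\sigma}&\frac{\tau}{\mu+\sigma+\tau}&\frac{\sigma+\tau}{\mu+2\sigma+\tau}\end{pmatrix},$$ $$V_{11}=\begin{pmatrix}\frac{\sigma}{\mu+\sigma}&0&-\frac{\mu\sigma}{(\mu+\tau)(\mu+\sigma+\tau)}&0\\ 0&\frac{\sigma}{\nu+\sigma}&0&-\frac{\nu\sigma}{(\nu+\tau)(\nu+\sigma+\tau)}\\ 0&-\frac{\sigma}{\mu+\nu+\sigma}&0&\frac{\sigma(\mu+\nu)}{(\mu+\nu+\tau)(\mu+\nu+\sigma+\tau)}\end{pmatrix},$$ $$V_{12}=\begin{pmatrix}0&\frac{\tau}{\mu+\tau}&0&-\frac{\mu\tau}{(\mu+\sigma)(\mu+\sigma+\tau)}\\ \frac{\tau}{\nu+\tau}&0&-\frac{\nu\tau}{(\nu+\sigma)(\nu+\sigma+\tau)}&0\\ 0&-\frac{\tau}{\mu+\nu+\tau}&0&\frac{\tau(\mu+\nu)}{(\mu+\nu+\sigma)(\mu+\nu+\sigma+\tau)}\end{pmatrix},$$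 $$V_{21}=\begin{pmatrix}\frac{\mu}{\mu+\sigma}&-\frac{\mu\sigma}{(\nu+\sigma)(\mu+\nu+\sigma)}&0&0\\ 0&0&\frac{\mu}{\mu+\tau}&-\frac{\mu\tau}{(\nu+\tau)(\mu+\nu+\tau)}\\ 0&0&-\frac{\mu}{\mu+\sigma+\tau}&\frac{\mu(\sigma+\tau)}{(\nu+\sigma+\tau)(\mu+\nu+\sigma+\tau)}\end{pmatrix},$$ $$V_{22}=\begin{pmatrix}0&0&\frac{\nu}{\nu+\sigma}&-\frac{\nu\sigma}{(\mu+\sigma)(\mu+\nu+\sigma)}\\ \frac{\nu}{\nu+\tau}&-\frac{\nu\tau}{(\mu+\tau)(\mu+\nu+\tau)}&0&0\\ 0&0&-\frac{\nu}{\nu+\sigma+\tau}&\frac{\nu(\sigma+\tau)}{(\mu+\sigma+\tau)(\mu+\nu+\sigma+\tau)}\end{pmatrix},$$ $$W=\begin{pmatrix}U_1V_{11}&U_1V_{12}\\ U_2V_{21}&U_2V_{22}\end{pmatrix}\in\mathbb R^{8\times8},$$ $$q_1=\begin{pmatrix}\frac{\mu^2+\mu\sigma+\sigma^2}{\mu\sigma(\mu+\sigma)}\\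 \frac{\mu\sigma(\mu+2\nu+\sigma)}{\nu(\mu+\nu)(\nu+\sigma)(\mu+\nu+\sigma)}\\ \frac{\mu\sigma(\mu+\sigma+2\tau)}{\tau(\mu+\tau)(\sigma+\tau)(\mu+\sigma+\tau)}\\ -\frac{\mu\sigma(\mu+2\nu+2\tau+\sigma)}{(\nu+\tau)(\mu+\nu+\tau)(\nu+\sigma+\tau)(\mu+\nu+\sigma+\tau)}\end{pmatrix},\qquad q_2=\begin{pmatrix}\frac{\nu^2+\nu\tau+\tau^2}{\nu\tau(\nu+\tau)}\\ \frac{\nu\tau(2\mu+\nu+\tau)}{\mu(\mu+\nu)(\mu+\tau)(\mu+\nu+\tau)}\\ \frac{\nu\tau(\nu+2\sigma+\tau)}{\sigma(\nu+\sigma)(\sigma+\tau)(\nu+\sigma+\tau)}\\ -\frac{\nu\tau(2\mu+\nu+2\sigma+\tau)}{(\mu+\sigma)(\mu+\nu+\sigma)(\mu+\sigma+\tau)(\mu+\nu+\sigma+\tau)}\end{pmatrix}.$$ Then the linear system $$(I-W)\omega=0,\qquad \omega_{10}+\omega_{20}=1,$$ for $\omega=(\omega_1^T,\omega_2^T)^T\in\mathbb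 R^8$ with $\omega_i=(\omega_{i0},\omega_{i1},\omega_{i2},\omega_{i3})^T$, has exactly one solution, and for this solution the Lyapunov exponent of the system is $q_1^T\omega_1+q_2^T\omega_2$: almost surely, $$\lambda=\lim_{k\to\infty}\frac1k\max(x(k),y(k))=q_1^T\omega_1+q_2^T\omega_2 .$$ -/

import Mathlib

open MeasureTheory ProbabilityTheory Filter Topology
open scoped Matrix

namespace MaxPlus

/-- One step of the max-plus linear recursion: the product of a `2 × 2` matrix and a vector
`z = (x, y)` in the semiring with maximum as addition and `+` as multiplication. -/
def mulVec (A : Matrix (Fin 2) (Fin 2) ℝ) (z : Fin 2 → ℝ) : Fin 2 → ℝ :=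
  fun i => max (z 0 + A i 0) (z 1 + A i 1)

/-- The trajectory `z(0) = (0, 0)`, `z(k) = A(k) z(k - 1)` for `k = 1, 2, …`, of the max-plus
system driven by the matrices `A(1), A(2), …`. -/
def state (A : ℕ+ → Matrix (Fin 2) (Fin 2) ℝ) : ℕ → Fin 2 → ℝ
  | 0 => 0
  | k + 1 => mulVec (A k.succPNat) (state A k)

/-- `lam` is the Lyapunov exponent of the random max-plus system: with probability one,
`max (x(k), y(k)) / k` tends to `lam`. -/
def IsLyapunovExponent {Ω : Type*} [MeasurableSpace Ω] (P : Measure Ω)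
    (A : ℕ+ → Ω → Matrix (Fin 2) (Fin 2) ℝ) (lam : ℝ) : Prop :=
  ∀ᵐ s ∂P, Tendsto
    (fun k : ℕ => (1 / (k : ℝ)) *
      max (state (fun n => A n s) k 0) (state (fun n => A n s) k 1))
    atTop (𝓝 lam)

/-- The general second-order exponential system: all the entries of all the matrices
`A(k) = (α_k, β_k; γ_k, δ_k)`, `k = 1, 2, …`, are mutually independent, and `α_k`, `β_k`, `γ_k`,
`δ_k` are exponentially distributed with parameters (rates) `μ`, `ν`, `σ`, `τ`. -/
structure IsExponentialSystem {Ω : Type*} [MeasurableSpace Ω] (P : Measure Ω)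
    (A : ℕ+ → Ω → Matrix (Fin 2) (Fin 2) ℝ) (μ ν σ τ : ℝ) : Prop where
  indep : iIndepFun (fun (p : ℕ+ × Fin 2 × Fin 2) (s : Ω) => A p.1 s p.2.1 p.2.2) P
  law_alpha : ∀ k, HasLaw (fun s => A k s 0 0) (expMeasure μ) P
  law_beta : ∀ k, HasLaw (fun s => A k s 0 1) (expMeasure ν) P
  law_gamma : ∀ k, HasLaw (fun s => A k s 1 0) (expMeasure σ) P
  law_delta : ∀ k, HasLaw (fun s => A k s 1 1) (expMeasure τ) P

noncomputable section

def U₁ (μ ν τ : ℝ) : Matrix (Fin 4) (Fin 3) ℝ :=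
  !![1, 1, 1;
     μ / (μ + ν), 1 / 2, (μ + ν) / (μ + 2 * ν);
     μ / (μ + τ), ν / (ν + τ), (μ + ν) / (μ + ν + τ);
     μ / (μ + ν + τ), ν / (2 * ν + τ), (μ + ν) / (μ + 2 * ν + τ)]

def U₂ (μ σ τ : ℝ) : Matrix (Fin 4) (Fin 3) ℝ :=
  !![1, 1, 1;
     σ / (μ + σ), τ / (μ + τ), (σ + τ) / (μ + σ + τ);
     1 / 2, τ / (σ + τ), (σ + τ) / (2 * σ + τ);
     σ / (μ + 2 * σ), τ / (μ + σ + τ), (σ + τ) / (μ + 2 * σ + τ)]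

def V₁₁ (μ ν σ τ : ℝ) : Matrix (Fin 3) (Fin 4) ℝ :=
  !![σ / (μ + σ), 0, -(μ * σ / ((μ + τ) * (μ + σ + τ))), 0;
     0, σ / (ν + σ), 0, -(ν * σ / ((ν + τ) * (ν + σ + τ)));
     0, -(σ / (μ + ν + σ)), 0, σ * (μ + ν) / ((μ + ν + τ) * (μ + ν + σ + τ))]

def V₁₂ (μ ν σ τ : ℝ) : Matrix (Fin 3) (Fin 4) ℝ :=
  !![0, τ / (μ + τ), 0, -(μ * τ / ((μ + σ) * (μ + σ + τ)));
     τ / (ν + τ), 0, -(ν * τ / ((ν + σ) * (ν + σ + τ))), 0;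
     0, -(τ / (μ + ν + τ)), 0, τ * (μ + ν) / ((μ + ν + σ) * (μ + ν + σ + τ))]

def V₂₁ (μ ν σ τ : ℝ) : Matrix (Fin 3) (Fin 4) ℝ :=
  !![μ / (μ + σ), -(μ * σ / ((ν + σ) * (μ + ν + σ))), 0, 0;
     0, 0, μ / (μ + τ), -(μ * τ / ((ν + τ) * (μ + ν + τ)));
     0, 0, -(μ / (μ + σ + τ)), μ * (σ + τ) / ((ν + σ + τ) * (μ + ν + σ + τ))]

def V₂₂ (μ ν σ τ : ℝ) : Matrix (Fin 3) (Fin 4) ℝ :=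
  !![0, 0, ν / (ν + σ), -(ν * σ / ((μ + σ) * (μ + ν + σ)));
     ν / (ν + τ), -(ν * τ / ((μ + τ) * (μ + ν + τ))), 0, 0;
     0, 0, -(ν / (ν + σ + τ)), ν * (σ + τ) / ((μ + σ + τ) * (μ + ν + σ + τ))]

/-- The `8 × 8` matrix `W`, in `4 × 4` blocks. -/
def W (μ ν σ τ : ℝ) : Matrix (Fin 4 ⊕ Fin 4) (Fin 4 ⊕ Fin 4) ℝ :=
  Matrix.fromBlocks
    (U₁ μ ν τ * V₁₁ μ ν σ τ) (U₁ μ ν τ * V₁₂ μ ν σ τ)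
    (U₂ μ σ τ * V₂₁ μ ν σ τ) (U₂ μ σ τ * V₂₂ μ ν σ τ)

def q₁ (μ ν σ τ : ℝ) : Fin 4 → ℝ :=
  ![(μ ^ 2 + μ * σ + σ ^ 2) / (μ * σ * (μ + σ)),
    μ * σ * (μ + 2 * ν + σ) / (ν * (μ + ν) * (ν + σ) * (μ + ν + σ)),
    μ * σ * (μ + σ + 2 * τ) / (τ * (μ + τ) * (σ + τ) * (μ + σ + τ)),
    -(μ * σ * (μ + 2 * ν + 2 * τ + σ) /
      ((ν + τ) * (μ + ν + τ) * (ν + σ + τ) * (μ + ν + σ + τ)))]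

def q₂ (μ ν σ τ : ℝ) : Fin 4 → ℝ :=
  ![(ν ^ 2 + ν * τ + τ ^ 2) / (ν * τ * (ν + τ)),
    ν * τ * (2 * μ + ν + τ) / (μ * (μ + ν) * (μ + τ) * (μ + ν + τ)),
    ν * τ * (ν + 2 * σ + τ) / (σ * (ν + σ) * (σ + τ) * (ν + σ + τ)),
    -(ν * τ * (2 * μ + ν + 2 * σ + τ) /
      ((μ + σ) * (μ + ν + σ) * (μ + σ + τ) * (μ + ν + σ + τ)))]

/-- `ω = (ω₁, ω₂)`, with `ω₁ = (ω₁₀, …, ω₁₃)` and `ω₂ = (ω₂₀, …, ω₂₃)`, solves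
`(I - W) ω = 0`, `ω₁₀ + ω₂₀ = 1`. -/
def IsSolution (μ ν σ τ : ℝ) (ω : Fin 4 ⊕ Fin 4 → ℝ) : Prop :=
  (1 - W μ ν σ τ) *ᵥ ω = 0 ∧ ω (Sum.inl 0) + ω (Sum.inr 0) = 1

end

end MaxPlus

/-!
The difference `d = y - x` of the coordinates is a Markov chain. By the lack of memory of the
exponential law, the difference after one step is a signed mixture of exponential laws on the two
half lines, with fixed rates and with weights that are combinations of the exponentials of
`expBasis` at `d`. The transition operator therefore preserves the span of this basis, where its
matrix is `W`; the mean growth of `max x y` in one step lies in the same span, with coefficients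
`q₁`, `q₂`.

Two steps of the chain contract oscillations, so constants are the only functions changed by a
constant under the transition operator. Hence `I - W` has corank one, which gives the unique
solution `ω`, and the Poisson equation for the mean growth is solvable with constant
`q₁ ⬝ᵥ ω₁ + q₂ ⬝ᵥ ω₂`. Its solution turns `max x y` into a process with centered increments up to
a linear drift and a bounded correction, whose second moment grows at most linearly: this gives the
limit along squares, and monotonicity of `max x y` fills in the rest.
-/

namespace MaxPlus

open scoped NNReal

noncomputable section

/-! ### The exponential distribution -/

instance (r : ℝ) : SFinite (expMeasure r) :=
  inferInstanceAs (SFinite (volume.withDensity (gammaPDF 1 r)))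

instance (r : ℝ) : NullSingletonClass (expMeasure r) :=
  inferInstanceAs (NullSingletonClass (volume.withDensity (gammaPDF 1 r)))

lemma expMeasure_eq_withDensity_Ioi (r : ℝ) :
    expMeasure r = (volume.restrict (Set.Ioi 0)).withDensity
      (fun x => ENNReal.ofReal (r * Real.exp (-(r * x)))) := by
  have hdensity : expMeasure r = volume.withDensity (exponentialPDF r) := rfl
  rw [hdensity, ← withDensity_indicator measurableSet_Ioi]
  refine withDensity_congr_ae ?_
  filter_upwards [Measure.ae_ne volume 0] with x hx
  rw [exponentialPDF_eq]
  rcases hx.lt_or_gt with h | h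
  · simp [h.not_ge, h.not_gt]
  · simp [h, h.le]

lemma integral_expMeasure {r : ℝ} (hr : 0 < r) (φ : ℝ → ℝ) :
    ∫ x, φ x ∂expMeasure r = ∫ x in Set.Ioi 0, r * Real.exp (-(r * x)) * φ x := by
  rw [expMeasure_eq_withDensity_Ioi,
    integral_withDensity_eq_integral_toReal_smul (by fun_prop) (by simp)]
  refine integral_congr_ae (Eventually.of_forall fun x => ?_)
  have : 0 ≤ r * Real.exp (-(r * x)) := by positivity
  simp [ENNReal.toReal_ofReal this]

lemma integrable_expMeasure_iff {r : ℝ} (hr : 0 < r) (φ : ℝ → ℝ) :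
    Integrable φ (expMeasure r) ↔
      IntegrableOn (fun x => r * Real.exp (-(r * x)) * φ x) (Set.Ioi 0) := by
  rw [expMeasure_eq_withDensity_Ioi,
    integrable_withDensity_iff_integrable_smul' (by fun_prop) (by simp), IntegrableOn]
  refine integrable_congr (Eventually.of_forall fun x => ?_)
  have : 0 ≤ r * Real.exp (-(r * x)) := by positivity
  simp [ENNReal.toReal_ofReal this]

lemma expMeasure_real_Iic {r : ℝ} (hr : 0 < r) (x : ℝ) :
    (expMeasure r).real (Set.Iic x) = if 0 ≤ x then 1 - Real.exp (-(r * x)) else 0 := by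
  have := isProbabilityMeasure_expMeasure hr
  rw [← cdf_expMeasure_eq hr, cdf_eq_real]

lemma ae_pos_expMeasure (r : ℝ) : ∀ᵐ x ∂expMeasure r, 0 < x := by
  rw [expMeasure_eq_withDensity_Ioi]
  exact (withDensity_absolutelyContinuous _ _).ae_le (ae_restrict_mem measurableSet_Ioi)

lemma integrable_pow_expMeasure {r : ℝ} (hr : 0 < r) (n : ℕ) :
    Integrable (fun x => x ^ n) (expMeasure r) := by
  rw [integrable_expMeasure_iff hr]
  have hgamma :
      IntegrableOn (fun x : ℝ => x ^ (n : ℝ) * Real.exp (-r * x ^ (1 : ℝ))) (Set.Ioi 0) :=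
    integrableOn_rpow_mul_exp_neg_mul_rpow (by linarith [n.cast_nonneg (α := ℝ)]) one_pos hr
  refine (hgamma.const_mul r).congr (Eventually.of_forall fun x => ?_)
  simp only [Real.rpow_natCast, Real.rpow_one, neg_mul]
  ring

lemma integrable_id_expMeasure {r : ℝ} (hr : 0 < r) :
    Integrable (fun x => x) (expMeasure r) := by
  simpa only [pow_one] using integrable_pow_expMeasure hr 1

lemma integral_id_expMeasure {r : ℝ} (hr : 0 < r) : ∫ x, x ∂expMeasure r = 1 / r := by
  have hgamma := Real.integral_rpow_mul_exp_neg_mul_Ioi two_pos hr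
  calc ∫ x, x ∂expMeasure r
      = r * ∫ x in Set.Ioi 0, x ^ ((2 : ℝ) - 1) * Real.exp (-(r * x)) := by
        rw [integral_expMeasure hr, ← integral_const_mul]
        norm_num [mul_comm, mul_left_comm]
    _ = 1 / r := by
        rw [hgamma, Real.Gamma_two, Real.rpow_two]
        field_simp

lemma integral_exp_expMeasure {r s : ℝ} (hr : 0 < r) (hs : 0 ≤ s) :
    ∫ x, Real.exp (-(s * x)) ∂expMeasure r = r / (r + s) := by
  calc ∫ x, Real.exp (-(s * x)) ∂expMeasure r
      = r * ∫ x in Set.Ioi 0, Real.exp (-(r + s) * x) := by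
        rw [integral_expMeasure hr, ← integral_const_mul]
        congr with x
        rw [mul_assoc, ← Real.exp_add]
        ring_nf
    _ = r / (r + s) := by
        rw [integral_exp_mul_Ioi (by linarith), mul_zero, Real.exp_zero, neg_div_neg_eq,
          mul_one_div]

lemma expMeasure_real_Ioc_pos {r x y : ℝ} (hr : 0 < r) (hx : 0 ≤ x) (hxy : x < y) :
    0 < (expMeasure r).real (Set.Ioc x y) := by
  have := isProbabilityMeasure_expMeasure hr
  rw [← Set.Iic_sdiff_Iic, measureReal_sdiff (Set.Iic_subset_Iic.2 hxy.le) measurableSet_Iic,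
    expMeasure_real_Iic hr, expMeasure_real_Iic hr, if_pos hx, if_pos (hx.trans hxy.le)]
  have : Real.exp (-(r * y)) < Real.exp (-(r * x)) := by gcongr
  linarith

lemma integral_indicator_Ioi_sub_expMeasure {r x : ℝ} (hr : 0 < r) (hx : 0 ≤ x) (f : ℝ → ℝ) :
    ∫ y, (Set.Ioi x).indicator (fun y => f (y - x)) y ∂expMeasure r =
      Real.exp (-(r * x)) * ∫ y, f y ∂expMeasure r := by
  calc ∫ y, (Set.Ioi x).indicator (fun y => f (y - x)) y ∂expMeasure r
      = ∫ y in Set.Ioi 0,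
          (Set.Ioi x).indicator (fun y => r * Real.exp (-(r * y)) * f (y - x)) y := by
        rw [integral_expMeasure hr]
        simp only [Set.indicator_apply, mul_ite, mul_zero]
    _ = ∫ y, (Set.Ioi x).indicator (fun y => r * Real.exp (-(r * y)) * f (y - x)) y := by
        rw [setIntegral_indicator measurableSet_Ioi, integral_indicator measurableSet_Ioi,
          Set.inter_eq_right.2 (Set.Ioi_subset_Ioi hx)]
    _ = ∫ y, (Set.Ioi 0).indicator
          (fun y => Real.exp (-(r * x)) * (r * Real.exp (-(r * y)) * f y)) y := by
        rw [← integral_add_right_eq_self _ x]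
        congr with y
        simp only [Set.indicator_apply, Set.mem_Ioi, lt_add_iff_pos_left, add_sub_cancel_right,
          mul_add, neg_add, Real.exp_add]
        congr 1
        ring
    _ = Real.exp (-(r * x)) * ∫ y, f y ∂expMeasure r := by
        rw [integral_indicator measurableSet_Ioi, integral_const_mul, integral_expMeasure hr]

lemma integral_sub_prod_expMeasure {r s : ℝ} (hr : 0 < r) (hs : 0 < s) {f : ℝ → ℝ}
    (hf : Integrable (fun p : ℝ × ℝ => f (p.2 - p.1)) ((expMeasure r).prod (expMeasure s))) :
    ∫ p, f (p.2 - p.1) ∂(expMeasure r).prod (expMeasure s) =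
      s / (r + s) * ∫ t, f (-t) ∂expMeasure r + r / (r + s) * ∫ t, f t ∂expMeasure s := by
  have hmeas : MeasurableSet {p : ℝ × ℝ | p.1 < p.2} :=
    measurableSet_lt measurable_fst measurable_snd
  have habove : ∫ p in {p | p.1 < p.2}, f (p.2 - p.1) ∂(expMeasure r).prod (expMeasure s) =
      r / (r + s) * ∫ t, f t ∂expMeasure s := by
    rw [← integral_indicator hmeas, integral_prod _ (hf.indicator hmeas),
      ← integral_exp_expMeasure hr hs.le, ← integral_mul_const]
    refine integral_congr_ae ?_
    filter_upwards [ae_pos_expMeasure r] with x hx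
    exact integral_indicator_Ioi_sub_expMeasure hs hx.le f
  have hbelow : ∫ p in {p | p.1 < p.2}ᶜ, f (p.2 - p.1) ∂(expMeasure r).prod (expMeasure s) =
      s / (r + s) * ∫ t, f (-t) ∂expMeasure r := by
    rw [← integral_indicator hmeas.compl, integral_prod_symm _ (hf.indicator hmeas.compl),
      add_comm r s, ← integral_exp_expMeasure hs hr.le, ← integral_mul_const]
    refine integral_congr_ae ?_
    filter_upwards [ae_pos_expMeasure s] with y hy
    rw [← integral_indicator_Ioi_sub_expMeasure hr hy.le fun t => f (-t)]
    refine integral_congr_ae ?_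
    filter_upwards [Measure.ae_ne (expMeasure r) y] with x hx
    simp [Set.indicator_apply, hx.symm.le_iff_lt]
  rw [← integral_add_compl hmeas hf, habove, hbelow, add_comm]

/-! ### The law of a maximum of exponential variables -/

/-- The weights with which the rates `a`, `b`, `a + b` enter the law of `max (X - x) (Y - y)`, for
independent exponential `X`, `Y` with rates `a`, `b` and `u = exp (-a x)`, `v = exp (-b y)`;
`F r` stands for an integral against the exponential law of rate `r`. -/
def maxMix (F : ℝ → ℝ) (a b u v : ℝ) : ℝ :=
  u * F a + v * F b - u * v * F (a + b)

lemma maxMix_congr {F G : ℝ → ℝ} {a b : ℝ} (h : ∀ r, 0 < r → F r = G r) (ha : 0 < a) (hb : 0 < b)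
    (u v : ℝ) : maxMix F a b u v = maxMix G a b u v := by
  rw [maxMix, maxMix, h a ha, h b hb, h (a + b) (add_pos ha hb)]

/-- `m` is the signed mixture `u E a + v E b - u v E (a + b)` of members of the family `E`. -/
def IsMaxMixture {α : Type*} [MeasurableSpace α] (E : ℝ → Measure α) (m : Measure α)
    (a b : ℝ) (u v : ℝ≥0) : Prop :=
  m + (u * v) • E (a + b) = u • E a + v • E b

namespace IsMaxMixture

variable {α β : Type*} [MeasurableSpace α] [MeasurableSpace β] {E : ℝ → Measure α} {m : Measure α}
  {a b : ℝ} {u v : ℝ≥0} {f : α → ℝ}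

lemma integrable (h : IsMaxMixture E m a b u v) (ha : Integrable f (E a))
    (hb : Integrable f (E b)) : Integrable f m :=
  ((ha.smul_measure_nnreal (c := u)).add_measure (hb.smul_measure_nnreal (c := v))).mono_measure
    (h ▸ Measure.le_add_right le_rfl)

lemma integral_eq (h : IsMaxMixture E m a b u v) (ha : Integrable f (E a))
    (hb : Integrable f (E b)) (hab : Integrable f (E (a + b))) :
    ∫ x, f x ∂m = maxMix (fun r => ∫ x, f x ∂E r) a b u v := by
  have hsum : ∫ x, f x ∂(m + (u * v) • E (a + b)) = ∫ x, f x ∂(u • E a + v • E b) :=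
    congrArg (fun ρ => ∫ x, f x ∂ρ) h
  rw [integral_add_measure (h.integrable ha hb) hab.smul_measure_nnreal,
    integral_add_measure ha.smul_measure_nnreal hb.smul_measure_nnreal] at hsum
  simp only [integral_smul_nnreal_measure, NNReal.smul_def, smul_eq_mul, NNReal.coe_mul] at hsum
  rw [maxMix, ← hsum, add_sub_cancel_right]

variable [∀ r, SFinite (E r)] [SFinite m]

lemma prod_right (h : IsMaxMixture E m a b u v) (n : Measure β) [SFinite n] :
    IsMaxMixture (fun r => (E r).prod n) (m.prod n) a b u v := by
  unfold IsMaxMixture at h ⊢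
  rw [← Measure.prod_smul_left, ← Measure.prod_smul_left, ← Measure.prod_smul_left,
    ← Measure.add_prod, ← Measure.add_prod, h]

lemma prod_left (h : IsMaxMixture E m a b u v) (n : Measure β) [SFinite n] :
    IsMaxMixture (fun r => n.prod (E r)) (n.prod m) a b u v := by
  unfold IsMaxMixture at h ⊢
  rw [← Measure.prod_smul_right, ← Measure.prod_smul_right, ← Measure.prod_smul_right,
    ← Measure.prod_add, ← Measure.prod_add, h]

end IsMaxMixture

/-- The larger of the two sums that make up a coordinate of `mulVec A z`, measured from the larger
coordinate of `z`: the sums are `z 0 + p.1` and `z 1 + p.2`, and `d = z 1 - z 0`. -/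
def rowMax (d : ℝ) (p : ℝ × ℝ) : ℝ :=
  max (p.1 - d⁺) (p.2 - d⁻)

lemma measurable_rowMax (d : ℝ) : Measurable (rowMax d) := by
  unfold rowMax
  fun_prop

lemma isMaxMixture_map_rowMax {a b : ℝ} (ha : 0 < a) (hb : 0 < b) (d : ℝ) :
    IsMaxMixture expMeasure (((expMeasure a).prod (expMeasure b)).map (rowMax d)) a b
      (Real.exp (-(a * d⁺))).toNNReal (Real.exp (-(b * d⁻))).toNNReal := by
  have := isProbabilityMeasure_expMeasure ha
  have := isProbabilityMeasure_expMeasure hb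
  have := isProbabilityMeasure_expMeasure (add_pos ha hb)
  refine Measure.ext_of_Iic _ _ fun t => ?_
  have hpre : rowMax d ⁻¹' Set.Iic t = Set.Iic (t + d⁺) ×ˢ Set.Iic (t + d⁻) := by
    ext p
    simp only [rowMax, Set.mem_preimage, Set.mem_Iic, max_le_iff, Set.mem_prod, sub_le_iff_le_add]
  rw [← measureReal_eq_measureReal_iff, measureReal_add_apply, measureReal_add_apply,
    map_measureReal_apply (measurable_rowMax d) measurableSet_Iic, hpre, measureReal_prod_prod]
  simp only [measureReal_nnreal_smul_apply, expMeasure_real_Iic, ha, hb, add_pos, NNReal.coe_mul,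
    Real.coe_toNNReal _ (Real.exp_nonneg _)]
  have hdisj : d⁺ = 0 ∨ d⁻ = 0 := by
    rcases le_total 0 d with hd | hd
    · exact Or.inr (negPart_of_nonneg hd)
    · exact Or.inl (posPart_of_nonpos hd)
  rcases le_or_gt 0 t with ht | ht
  · rw [if_pos (add_nonneg ht (posPart_nonneg d)), if_pos (add_nonneg ht (negPart_nonneg d))]
    simp only [if_pos ht, mul_add, add_mul, neg_add, Real.exp_add]
    rcases hdisj with h | h <;> rw [h, mul_zero, neg_zero, Real.exp_zero] <;> ring
  · simp only [if_neg ht.not_ge]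
    rcases hdisj with h | h <;> rw [h, add_zero, if_neg ht.not_ge] <;> ring

lemma integral_max_prod_expMeasure {r s : ℝ} (hr : 0 < r) (hs : 0 < s) :
    ∫ p, max p.1 p.2 ∂(expMeasure r).prod (expMeasure s) = 1 / r + 1 / s - 1 / (r + s) := by
  have hmix := (isMaxMixture_map_rowMax hr hs 0).integral_eq (integrable_id_expMeasure hr)
    (integrable_id_expMeasure hs) (integrable_id_expMeasure (add_pos hr hs))
  rw [integral_map (measurable_rowMax 0).aemeasurable (by fun_prop)] at hmix
  simpa [maxMix, rowMax, integral_id_expMeasure, hr, hs, add_pos] using hmix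

/-! ### One step of the recursion -/

/-- The law of the entries `((α, β), (γ, δ))` of one matrix. -/
def noiseLaw (μ ν σ τ : ℝ) : Measure ((ℝ × ℝ) × (ℝ × ℝ)) :=
  ((expMeasure μ).prod (expMeasure ν)).prod ((expMeasure σ).prod (expMeasure τ))

/-- The difference `y - x` of the coordinates after a step from a state with difference `d`. -/
def nextDiff (d : ℝ) (a : (ℝ × ℝ) × (ℝ × ℝ)) : ℝ :=
  rowMax d a.2 - rowMax d a.1

/-- The growth of the larger coordinate in a step from a state with difference `d`. -/
def maxIncr (d : ℝ) (a : (ℝ × ℝ) × (ℝ × ℝ)) : ℝ :=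
  max (rowMax d a.1) (rowMax d a.2)

instance (μ ν σ τ : ℝ) : SFinite (noiseLaw μ ν σ τ) := by
  unfold noiseLaw
  infer_instance

lemma isProbabilityMeasure_noiseLaw {μ ν σ τ : ℝ} (hμ : 0 < μ) (hν : 0 < ν) (hσ : 0 < σ)
    (hτ : 0 < τ) : IsProbabilityMeasure (noiseLaw μ ν σ τ) := by
  have := isProbabilityMeasure_expMeasure hμ
  have := isProbabilityMeasure_expMeasure hν
  have := isProbabilityMeasure_expMeasure hσ
  have := isProbabilityMeasure_expMeasure hτ
  unfold noiseLaw
  infer_instance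

section RowMaxIntegrals

variable {μ ν σ τ : ℝ} (hμ : 0 < μ) (hν : 0 < ν) (hσ : 0 < σ) (hτ : 0 < τ) (d : ℝ)
  {Φ : ℝ × ℝ → ℝ}
  (hΦ : ∀ r s, 0 < r → 0 < s → Integrable Φ ((expMeasure r).prod (expMeasure s)))
include hμ hν hσ hτ hΦ

lemma integral_rowMax_noiseLaw :
    ∫ a, Φ (rowMax d a.1, rowMax d a.2) ∂noiseLaw μ ν σ τ =
      maxMix (fun r => maxMix (fun s => ∫ p, Φ p ∂(expMeasure r).prod (expMeasure s)) σ τ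
          (Real.exp (-(σ * d⁺))) (Real.exp (-(τ * d⁻)))) μ ν
        (Real.exp (-(μ * d⁺))) (Real.exp (-(ν * d⁻))) := by
  set m₁ := ((expMeasure μ).prod (expMeasure ν)).map (rowMax d)
  set m₂ := ((expMeasure σ).prod (expMeasure τ)).map (rowMax d)
  have hmap : (noiseLaw μ ν σ τ).map (Prod.map (rowMax d) (rowMax d)) = m₁.prod m₂ :=
    (Measure.map_prod_map _ _ (measurable_rowMax d) (measurable_rowMax d)).symm
  have hsecond (r : ℝ) := (isMaxMixture_map_rowMax hσ hτ d).prod_left (expMeasure r)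
  have hint {r : ℝ} (hr : 0 < r) : Integrable Φ ((expMeasure r).prod m₂) :=
    (hsecond r).integrable (hΦ r σ hr hσ) (hΦ r τ hr hτ)
  have hfirst := (isMaxMixture_map_rowMax hμ hν d).prod_right m₂
  have hintegrable : Integrable Φ (m₁.prod m₂) := hfirst.integrable (hint hμ) (hint hν)
  calc ∫ a, Φ (rowMax d a.1, rowMax d a.2) ∂noiseLaw μ ν σ τ
      = ∫ p, Φ p ∂m₁.prod m₂ := by
        rw [← hmap] at hintegrable ⊢
        rw [integral_map ((measurable_rowMax d).prodMap (measurable_rowMax d)).aemeasurable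
          hintegrable.aestronglyMeasurable]
        rfl
    _ = _ := by
        rw [hfirst.integral_eq (hint hμ) (hint hν) (hint (add_pos hμ hν)),
          Real.coe_toNNReal _ (Real.exp_nonneg _), Real.coe_toNNReal _ (Real.exp_nonneg _)]
        refine maxMix_congr (fun r hr => ?_) hμ hν _ _
        rw [(hsecond r).integral_eq (hΦ r σ hr hσ) (hΦ r τ hr hτ) (hΦ r _ hr (add_pos hσ hτ)),
          Real.coe_toNNReal _ (Real.exp_nonneg _), Real.coe_toNNReal _ (Real.exp_nonneg _)]

end RowMaxIntegrals

/-! ### The span of exponentials preserved by the transition operator -/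

/-- The transition operator of the Markov chain formed by the differences `y(k) - x(k)`. -/
def transition (μ ν σ τ : ℝ) (f : ℝ → ℝ) (d : ℝ) : ℝ :=
  ∫ a, f (nextDiff d a) ∂noiseLaw μ ν σ τ

/-- The exponents of the basis functions on the half line `d ≤ 0`. -/
def rate₁ (ν τ : ℝ) : Fin 4 → ℝ := ![0, ν, τ, ν + τ]

/-- The exponents of the basis functions on the half line `0 < d`. -/
def rate₂ (μ σ : ℝ) : Fin 4 → ℝ := ![0, μ, σ, μ + σ]

/-- The exponential functions, supported on either half line, whose span is preserved by
`transition`; the index matches that of the vector `ω`. -/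
def expBasis (μ ν σ τ d : ℝ) : Fin 4 ⊕ Fin 4 → ℝ :=
  Sum.elim (fun i => if d ≤ 0 then Real.exp (rate₁ ν τ i * d) else 0)
    (fun i => if 0 < d then Real.exp (-(rate₂ μ σ i * d)) else 0)

/-- The block diagonal matrix of `U₁` and `U₂`. -/
def U (μ ν σ τ : ℝ) : Matrix (Fin 4 ⊕ Fin 4) (Fin 3 ⊕ Fin 3) ℝ :=
  Matrix.fromBlocks (U₁ μ ν τ) 0 0 (U₂ μ σ τ)

/-- The matrix with blocks `V₁₁`, `V₁₂`, `V₂₁`, `V₂₂`. -/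
def V (μ ν σ τ : ℝ) : Matrix (Fin 3 ⊕ Fin 3) (Fin 4 ⊕ Fin 4) ℝ :=
  Matrix.fromBlocks (V₁₁ μ ν σ τ) (V₁₂ μ ν σ τ) (V₂₁ μ ν σ τ) (V₂₂ μ ν σ τ)

lemma U_mul_V (μ ν σ τ : ℝ) : U μ ν σ τ * V μ ν σ τ = W μ ν σ τ := by
  simp only [U, V, W, Matrix.fromBlocks_multiply, Matrix.zero_mul, add_zero, zero_add]

/-- The integrals of `f` against the laws that make up the law of the next difference: exponential
laws on the negative half line with the rates of the first row of the matrices and their sum, and on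
the positive half line with the rates of the second row and their sum. -/
def halfLineIntegrals (μ ν σ τ : ℝ) (f : ℝ → ℝ) : Fin 3 ⊕ Fin 3 → ℝ :=
  Sum.elim (fun j => ∫ t, f (-t) ∂expMeasure (![μ, ν, μ + ν] j))
    (fun j => ∫ t, f t ∂expMeasure (![σ, τ, σ + τ] j))

lemma expBasis_of_nonpos {μ ν σ τ d : ℝ} (hd : d ≤ 0) :
    expBasis μ ν σ τ d = Sum.elim ![1, Real.exp (-(ν * d⁻)), Real.exp (-(τ * d⁻)),
      Real.exp (-(ν * d⁻)) * Real.exp (-(τ * d⁻))] 0 := by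
  rw [negPart_of_nonpos hd]
  ext (i | i) <;> fin_cases i <;> simp [expBasis, rate₁, hd, hd.not_gt, add_mul, Real.exp_add]

lemma expBasis_of_pos {μ ν σ τ d : ℝ} (hd : 0 < d) :
    expBasis μ ν σ τ d = Sum.elim (0 : Fin 4 → ℝ) ![1, Real.exp (-(μ * d⁺)), Real.exp (-(σ * d⁺)),
      Real.exp (-(μ * d⁺)) * Real.exp (-(σ * d⁺))] := by
  rw [posPart_of_nonneg hd.le]
  ext (i | i) <;> fin_cases i <;>
    simp [expBasis, rate₂, hd, hd.not_ge, add_mul, add_comm, Real.exp_add]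

section

variable {μ ν σ τ : ℝ} (hμ : 0 < μ) (hν : 0 < ν) (hσ : 0 < σ) (hτ : 0 < τ)
include hμ hν hσ hτ

lemma V_mulVec_expBasis (d : ℝ) {u₁ v₁ u₂ v₂ : ℝ}
    (hu₁ : Real.exp (-(μ * d⁺)) = u₁) (hv₁ : Real.exp (-(ν * d⁻)) = v₁)
    (hu₂ : Real.exp (-(σ * d⁺)) = u₂) (hv₂ : Real.exp (-(τ * d⁻)) = v₂) :
    V μ ν σ τ *ᵥ expBasis μ ν σ τ d =
      Sum.elim
        (![u₁, v₁, -(u₁ * v₁)] * fun j => maxMix (fun s => s / (![μ, ν, μ + ν] j + s)) σ τ u₂ v₂)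
        (![u₂, v₂, -(u₂ * v₂)] *
          fun j => maxMix (fun r => r / (r + ![σ, τ, σ + τ] j)) μ ν u₁ v₁) := by
  rcases le_or_gt d 0 with hd | hd
  · rw [expBasis_of_nonpos hd, hv₁, hv₂, V, Matrix.fromBlocks_mulVec]
    obtain rfl : u₁ = 1 := by simp [← hu₁, posPart_of_nonpos hd]
    obtain rfl : u₂ = 1 := by simp [← hu₂, posPart_of_nonpos hd]
    ext (i | i) <;> fin_cases i <;>
      simp [V₁₁, V₂₁, maxMix] <;> field_simp <;> ring
  · rw [expBasis_of_pos hd, hu₁, hu₂, V, Matrix.fromBlocks_mulVec]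
    obtain rfl : v₁ = 1 := by simp [← hv₁, negPart_of_nonneg hd.le]
    obtain rfl : v₂ = 1 := by simp [← hv₂, negPart_of_nonneg hd.le]
    ext (i | i) <;> fin_cases i <;>
      simp [V₁₂, V₂₂, maxMix] <;> field_simp <;> ring

lemma transition_eq_dotProduct {f : ℝ → ℝ}
    (hf : ∀ r s, 0 < r → 0 < s →
      Integrable (fun p : ℝ × ℝ => f (p.2 - p.1)) ((expMeasure r).prod (expMeasure s))) (d : ℝ) :
    transition μ ν σ τ f d =
      (V μ ν σ τ *ᵥ expBasis μ ν σ τ d) ⬝ᵥ halfLineIntegrals μ ν σ τ f := by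
  calc transition μ ν σ τ f d
      = maxMix (fun r => maxMix (fun s => s / (r + s) * ∫ t, f (-t) ∂expMeasure r +
            r / (r + s) * ∫ t, f t ∂expMeasure s) σ τ
          (Real.exp (-(σ * d⁺))) (Real.exp (-(τ * d⁻)))) μ ν
          (Real.exp (-(μ * d⁺))) (Real.exp (-(ν * d⁻))) :=
        (integral_rowMax_noiseLaw hμ hν hσ hτ d hf).trans <|
          maxMix_congr (fun r hr => maxMix_congr (fun s hs =>
            integral_sub_prod_expMeasure hr hs (hf r s hr hs)) hσ hτ _ _) hμ hν _ _
    _ = (V μ ν σ τ *ᵥ expBasis μ ν σ τ d) ⬝ᵥ halfLineIntegrals μ ν σ τ f := by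
        rw [V_mulVec_expBasis hμ hν hσ hτ d rfl rfl rfl rfl]
        simp only [dotProduct, Fintype.sum_sum_type, Fin.sum_univ_three, maxMix, halfLineIntegrals,
          Sum.elim_inl, Sum.elim_inr, Pi.mul_apply, Matrix.cons_val_zero, Matrix.cons_val_one,
          Matrix.cons_val]
        ring

end

lemma measurable_expBasis (μ ν σ τ : ℝ) (i : Fin 4 ⊕ Fin 4) :
    Measurable (fun d => expBasis μ ν σ τ d i) := by
  rcases i with i | i
  · exact Measurable.ite measurableSet_Iic (by fun_prop) measurable_const
  · exact Measurable.ite measurableSet_Ioi (by fun_prop) measurable_const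

section

variable {μ ν σ τ : ℝ}

lemma rate₁_nonneg (hν : 0 < ν) (hτ : 0 < τ) (i : Fin 4) : 0 ≤ rate₁ ν τ i := by
  fin_cases i
  exacts [le_rfl, hν.le, hτ.le, (add_pos hν hτ).le]

lemma rate₂_nonneg (hμ : 0 < μ) (hσ : 0 < σ) (i : Fin 4) : 0 ≤ rate₂ μ σ i := by
  fin_cases i
  exacts [le_rfl, hμ.le, hσ.le, (add_pos hμ hσ).le]

lemma U₁_apply (hμ : 0 < μ) (hν : 0 < ν) (i : Fin 4) (j : Fin 3) :
    U₁ μ ν τ i j = ![μ, ν, μ + ν] j / (![μ, ν, μ + ν] j + rate₁ ν τ i) := by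
  have := hμ.ne'
  have := hν.ne'
  have := (add_pos hμ hν).ne'
  fin_cases i <;> fin_cases j <;> simp [U₁, rate₁, *] <;> field_simp <;> ring

lemma U₂_apply (hσ : 0 < σ) (hτ : 0 < τ) (i : Fin 4) (j : Fin 3) :
    U₂ μ σ τ i j = ![σ, τ, σ + τ] j / (![σ, τ, σ + τ] j + rate₂ μ σ i) := by
  have := hσ.ne'
  have := hτ.ne'
  have := (add_pos hσ hτ).ne'
  fin_cases i <;> fin_cases j <;> simp [U₂, rate₂, *] <;> field_simp <;> ring

lemma vecCons_add_pos {a b : ℝ} (ha : 0 < a) (hb : 0 < b) (j : Fin 3) : 0 < ![a, b, a + b] j := by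
  fin_cases j
  exacts [ha, hb, add_pos ha hb]

variable (hμ : 0 < μ) (hν : 0 < ν) (hσ : 0 < σ) (hτ : 0 < τ)
include hμ hν hσ hτ

lemma abs_expBasis_le_one (d : ℝ) (i : Fin 4 ⊕ Fin 4) : |expBasis μ ν σ τ d i| ≤ 1 := by
  rcases i with i | i
  · simp only [expBasis, Sum.elim_inl]
    split_ifs with hd
    · rw [Real.abs_exp, Real.exp_le_one_iff]
      exact mul_nonpos_of_nonneg_of_nonpos (rate₁_nonneg hν hτ i) hd
    · simp
  · simp only [expBasis, Sum.elim_inr]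
    split_ifs with hd
    · rw [Real.abs_exp, Real.exp_le_one_iff, neg_nonpos]
      exact mul_nonneg (rate₂_nonneg hμ hσ i) hd.le
    · simp

lemma integrable_expBasis {α : Type*} [MeasurableSpace α] {m : Measure α} [IsFiniteMeasure m]
    {g : α → ℝ} (hg : Measurable g) (i : Fin 4 ⊕ Fin 4) :
    Integrable (fun x => expBasis μ ν σ τ (g x) i) m :=
  Integrable.of_bound ((measurable_expBasis μ ν σ τ i).comp hg).aestronglyMeasurable 1
    (Eventually.of_forall fun x => abs_expBasis_le_one hμ hν hσ hτ (g x) i)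

lemma integral_dotProduct_expBasis {α : Type*} [MeasurableSpace α] {m : Measure α}
    [IsFiniteMeasure m] {g : α → ℝ} (hg : Measurable g) (c : Fin 4 ⊕ Fin 4 → ℝ) :
    ∫ x, c ⬝ᵥ expBasis μ ν σ τ (g x) ∂m = ∑ i, c i * ∫ x, expBasis μ ν σ τ (g x) i ∂m := by
  simp only [dotProduct]
  rw [integral_finsetSum _ fun i _ => (integrable_expBasis hμ hν hσ hτ hg i).const_mul (c i)]
  simp only [integral_const_mul]

lemma halfLineIntegrals_expBasis (i : Fin 4 ⊕ Fin 4) :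
    halfLineIntegrals μ ν σ τ (fun d => expBasis μ ν σ τ d i) = U μ ν σ τ i := by
  ext (j | j)
  · have ha := vecCons_add_pos hμ hν j
    rcases i with i | i
    · refine Eq.trans ?_ (U₁_apply hμ hν i j).symm
      rw [← integral_exp_expMeasure ha (rate₁_nonneg hν hτ i)]
      refine integral_congr_ae ?_
      filter_upwards [ae_pos_expMeasure _] with t ht
      simp [expBasis, ht.le]
    · refine integral_eq_zero_of_ae ?_
      filter_upwards [ae_pos_expMeasure _] with t ht
      simp [expBasis, ht.le]
  · have ha := vecCons_add_pos hσ hτ j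
    rcases i with i | i
    · refine integral_eq_zero_of_ae ?_
      filter_upwards [ae_pos_expMeasure _] with t ht
      simp [expBasis, ht]
    · refine Eq.trans ?_ (U₂_apply hσ hτ i j).symm
      rw [← integral_exp_expMeasure ha (rate₂_nonneg hμ hσ i)]
      refine integral_congr_ae ?_
      filter_upwards [ae_pos_expMeasure _] with t ht
      simp [expBasis, ht]

lemma halfLineIntegrals_dotProduct_expBasis (c : Fin 4 ⊕ Fin 4 → ℝ) :
    halfLineIntegrals μ ν σ τ (fun d => c ⬝ᵥ expBasis μ ν σ τ d) = c ᵥ* U μ ν σ τ := by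
  ext j
  simp only [Matrix.vecMul, dotProduct, ← halfLineIntegrals_expBasis hμ hν hσ hτ]
  rcases j with j | j
  · have := isProbabilityMeasure_expMeasure (vecCons_add_pos hμ hν j)
    exact integral_dotProduct_expBasis hμ hν hσ hτ measurable_neg c
  · have := isProbabilityMeasure_expMeasure (vecCons_add_pos hσ hτ j)
    exact integral_dotProduct_expBasis hμ hν hσ hτ measurable_id c

lemma transition_dotProduct_expBasis (c : Fin 4 ⊕ Fin 4 → ℝ) (d : ℝ) :
    transition μ ν σ τ (fun d => c ⬝ᵥ expBasis μ ν σ τ d) d =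
      (c ᵥ* W μ ν σ τ) ⬝ᵥ expBasis μ ν σ τ d := by
  rw [transition_eq_dotProduct hμ hν hσ hτ, halfLineIntegrals_dotProduct_expBasis hμ hν hσ hτ,
    dotProduct_comm, Matrix.dotProduct_mulVec, Matrix.vecMul_vecMul, U_mul_V]
  intro r s hr hs
  have := isProbabilityMeasure_expMeasure hr
  have := isProbabilityMeasure_expMeasure hs
  exact integrable_finsetSum _ fun i _ =>
    (integrable_expBasis hμ hν hσ hτ (by fun_prop) i).const_mul (c i)

end

/-! ### The mean growth in one step -/

/-- The mean of the maximum of two independent exponential variables with rates `r` and `s`. -/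
def meanMax (r s : ℝ) : ℝ := 1 / r + 1 / s - 1 / (r + s)

lemma q₁_eq_meanMax {μ ν σ τ : ℝ} (hμ : 0 < μ) (hν : 0 < ν) (hσ : 0 < σ) (hτ : 0 < τ) :
    q₁ μ ν σ τ = ![meanMax μ σ, meanMax ν σ - meanMax (μ + ν) σ, meanMax μ τ - meanMax μ (σ + τ),
      meanMax ν τ - meanMax ν (σ + τ) - meanMax (μ + ν) τ + meanMax (μ + ν) (σ + τ)] := by
  ext i
  fin_cases i <;> simp [q₁, meanMax] <;> field_simp <;> ring

lemma q₂_eq_q₁ (μ ν σ τ : ℝ) : q₂ μ ν σ τ = q₁ ν μ τ σ := by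
  ext i
  fin_cases i <;> simp [q₁, q₂] <;> ring

lemma integral_maxIncr {μ ν σ τ : ℝ} (hμ : 0 < μ) (hν : 0 < ν) (hσ : 0 < σ) (hτ : 0 < τ) (d : ℝ) :
    ∫ a, maxIncr d a ∂noiseLaw μ ν σ τ =
      Sum.elim (q₁ μ ν σ τ) (q₂ μ ν σ τ) ⬝ᵥ expBasis μ ν σ τ d := by
  have hmax (r s : ℝ) (hr : 0 < r) (hs : 0 < s) :
      Integrable (fun p : ℝ × ℝ => max p.1 p.2) ((expMeasure r).prod (expMeasure s)) := by
    have := isProbabilityMeasure_expMeasure hr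
    have := isProbabilityMeasure_expMeasure hs
    exact ((integrable_id_expMeasure hr).comp_fst _).sup ((integrable_id_expMeasure hs).comp_snd _)
  calc ∫ a, maxIncr d a ∂noiseLaw μ ν σ τ
      = maxMix (fun r => maxMix (meanMax r) σ τ (Real.exp (-(σ * d⁺))) (Real.exp (-(τ * d⁻)))) μ ν
          (Real.exp (-(μ * d⁺))) (Real.exp (-(ν * d⁻))) :=
        (integral_rowMax_noiseLaw hμ hν hσ hτ d hmax).trans <|
          maxMix_congr (fun r hr => maxMix_congr (fun s hs =>
            integral_max_prod_expMeasure hr hs) hσ hτ _ _) hμ hν _ _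
    _ = Sum.elim (q₁ μ ν σ τ) (q₂ μ ν σ τ) ⬝ᵥ expBasis μ ν σ τ d := by
        rw [q₂_eq_q₁, q₁_eq_meanMax hμ hν hσ hτ, q₁_eq_meanMax hν hμ hτ hσ]
        rcases le_or_gt d 0 with hd | hd
        · rw [expBasis_of_nonpos hd, posPart_of_nonpos hd]
          simp [maxMix]
          ring
        · rw [expBasis_of_pos hd, negPart_of_nonneg hd.le]
          simp [maxMix, add_comm]
          ring

/-! ### Two steps contract the oscillation -/

/-- The oscillation of `f`, the supremum of the distances between its values, is at most `K`. -/
def OscLE {α : Type*} (f : α → ℝ) (K : ℝ) : Prop := ∀ x y, |f x - f y| ≤ K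

lemma OscLE.integrable_comp {α β : Type*} [MeasurableSpace α] [MeasurableSpace β] [Nonempty β]
    {f : β → ℝ} {K : ℝ} (hK : OscLE f K) (hf : Measurable f) {g : α → β} (hg : Measurable g)
    (m : Measure α) [IsFiniteMeasure m] : Integrable (fun x => f (g x)) m := by
  let y := Classical.arbitrary β
  refine Integrable.of_bound (hf.comp hg).aestronglyMeasurable (K + |f y|)
    (Eventually.of_forall fun x => ?_)
  calc |f (g x)| = |(f (g x) - f y) + f y| := by rw [sub_add_cancel]
    _ ≤ K + |f y| := (abs_add_le _ _).trans (by gcongr; exact hK _ _)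

lemma abs_integral_sub_integral_le {α : Type*} [MeasurableSpace α] {m : Measure α}
    [IsProbabilityMeasure m] {f g : α → ℝ} (hf : Integrable f m) (hg : Integrable g m)
    {G : Set α} (hG : MeasurableSet G) {K K' : ℝ} (hK : ∀ x, |f x - g x| ≤ K)
    (hK' : ∀ x ∈ G, |f x - g x| ≤ K') :
    |∫ x, f x ∂m - ∫ x, g x ∂m| ≤ K - (K - K') * m.real G := by
  have hind : Integrable (G.indicator fun _ => K - K') m := (integrable_const _).indicator hG
  rw [← integral_sub hf hg]
  calc |∫ x, (f x - g x) ∂m| ≤ ∫ x, |f x - g x| ∂m := abs_integral_le_integral_abs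
    _ ≤ ∫ x, (K - G.indicator (fun _ => K - K') x) ∂m := by
        refine integral_mono (hf.sub hg).abs ((integrable_const _).sub hind) fun x => ?_
        by_cases hx : x ∈ G
        · simpa [hx] using hK' x hx
        · simpa [hx] using hK x
    _ = K - (K - K') * m.real G := by
        rw [integral_sub (integrable_const _) hind, integral_indicator_const _ hG]
        simp [mul_comm]

lemma measurable_uncurry_nextDiff : Measurable (Function.uncurry nextDiff) := by
  unfold Function.uncurry nextDiff rowMax
  simp only [posPart_def, negPart_def]
  fun_prop

lemma measurable_nextDiff (d : ℝ) : Measurable (nextDiff d) :=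
  measurable_uncurry_nextDiff.of_uncurry_left

lemma measurable_transition (μ ν σ τ : ℝ) {f : ℝ → ℝ} (hf : Measurable f) :
    Measurable (transition μ ν σ τ f) :=
  (hf.comp measurable_uncurry_nextDiff).stronglyMeasurable.integral_prod_right'.measurable

lemma rowMax_mem_Ioc_zero_one {p : ℝ × ℝ} (hp : p ∈ Set.Ioc (0 : ℝ) 1 ×ˢ Set.Ioc (0 : ℝ) 1)
    (d : ℝ) : rowMax d p ∈ Set.Ioc (0 : ℝ) 1 := by
  obtain ⟨⟨h₁, h₁'⟩, h₂, h₂'⟩ := hp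
  rcases le_total d 0 with hd | hd
  · rw [rowMax, posPart_of_nonpos hd, sub_zero]
    exact ⟨lt_max_of_lt_left h₁, max_le h₁' (by linarith [negPart_nonneg d])⟩
  · rw [rowMax, negPart_of_nonneg hd, sub_zero]
    exact ⟨lt_max_of_lt_right h₂, max_le (by linarith [posPart_nonneg d]) h₂'⟩

lemma abs_nextDiff_le_one {a : (ℝ × ℝ) × (ℝ × ℝ)}
    (ha : a ∈ (Set.Ioc (0 : ℝ) 1 ×ˢ Set.Ioc (0 : ℝ) 1) ×ˢ (Set.Ioc (0 : ℝ) 1 ×ˢ Set.Ioc (0 : ℝ) 1))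
    (d : ℝ) : |nextDiff d a| ≤ 1 := by
  obtain ⟨h₁, h₁'⟩ := rowMax_mem_Ioc_zero_one ha.1 d
  obtain ⟨h₂, h₂'⟩ := rowMax_mem_Ioc_zero_one ha.2 d
  rw [nextDiff, abs_le]
  constructor <;> linarith

lemma rowMax_eq_fst_sub_posPart {p : ℝ × ℝ}
    (hp : p ∈ Set.Ioc (2 : ℝ) 3 ×ˢ Set.Ioc (0 : ℝ) 1) {d : ℝ} (hd : |d| ≤ 1) :
    rowMax d p = p.1 - d⁺ := by
  obtain ⟨⟨h₁, -⟩, -, h₂⟩ := hp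
  have : d⁺ + d⁻ ≤ 1 := (posPart_add_negPart d).trans_le hd
  exact max_eq_left (by linarith [negPart_nonneg d])

lemma nextDiff_eq_sub_fst {a : (ℝ × ℝ) × (ℝ × ℝ)}
    (ha : a ∈ (Set.Ioc (2 : ℝ) 3 ×ˢ Set.Ioc (0 : ℝ) 1) ×ˢ (Set.Ioc (2 : ℝ) 3 ×ˢ Set.Ioc (0 : ℝ) 1))
    {d : ℝ} (hd : |d| ≤ 1) : nextDiff d a = a.2.1 - a.1.1 := by
  rw [nextDiff, rowMax_eq_fst_sub_posPart ha.1 hd, rowMax_eq_fst_sub_posPart ha.2 hd,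
    sub_sub_sub_cancel_right]

section

variable {μ ν σ τ : ℝ} (hμ : 0 < μ) (hν : 0 < ν) (hσ : 0 < σ) (hτ : 0 < τ)
include hμ hν hσ hτ

lemma noiseLaw_real_prod_Ioc_pos {x₁ y₁ x₂ y₂ : ℝ} (hx₁ : 0 ≤ x₁) (hxy₁ : x₁ < y₁)
    (hx₂ : 0 ≤ x₂) (hxy₂ : x₂ < y₂) :
    0 < (noiseLaw μ ν σ τ).real
      ((Set.Ioc x₁ y₁ ×ˢ Set.Ioc x₂ y₂) ×ˢ (Set.Ioc x₁ y₁ ×ˢ Set.Ioc x₂ y₂)) := by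
  simp only [noiseLaw, measureReal_prod_prod]
  have hpos {r : ℝ} (hr : 0 < r) :
      0 < (expMeasure r).real (Set.Ioc x₁ y₁) ∧ 0 < (expMeasure r).real (Set.Ioc x₂ y₂) :=
    ⟨expMeasure_real_Ioc_pos hr hx₁ hxy₁, expMeasure_real_Ioc_pos hr hx₂ hxy₂⟩
  exact mul_pos (mul_pos (hpos hμ).1 (hpos hν).2) (mul_pos (hpos hσ).1 (hpos hτ).2)

lemma OscLE.transition {f : ℝ → ℝ} {K : ℝ} (hK : OscLE f K) (hf : Measurable f) :
    OscLE (transition μ ν σ τ f) K := fun d d' => by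
  have := isProbabilityMeasure_noiseLaw hμ hν hσ hτ
  have h := abs_integral_sub_integral_le (m := noiseLaw μ ν σ τ)
    (hK.integrable_comp hf (measurable_nextDiff d) _)
    (hK.integrable_comp hf (measurable_nextDiff d') _) MeasurableSet.empty
    (fun _ => hK _ _) (K' := K) (fun _ _ => hK _ _)
  rwa [sub_self, zero_mul, sub_zero] at h

/-- From any state, the difference enters `[-1, 1]` in one step with positive probability, and from
there the next difference is, with positive probability, a function of the noise alone. -/
lemma exists_oscLE_transition_transition : ∃ θ : ℝ, 0 ≤ θ ∧ θ < 1 ∧ ∀ {f : ℝ → ℝ} {K : ℝ},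
    Measurable f → OscLE f K →
      OscLE (transition μ ν σ τ (transition μ ν σ τ f)) (θ * K) := by
  have := isProbabilityMeasure_noiseLaw hμ hν hσ hτ
  set P := noiseLaw μ ν σ τ
  set G₁ : Set ((ℝ × ℝ) × (ℝ × ℝ)) :=
    (Set.Ioc (0 : ℝ) 1 ×ˢ Set.Ioc (0 : ℝ) 1) ×ˢ (Set.Ioc (0 : ℝ) 1 ×ˢ Set.Ioc (0 : ℝ) 1)
  set G₂ : Set ((ℝ × ℝ) × (ℝ × ℝ)) :=
    (Set.Ioc (2 : ℝ) 3 ×ˢ Set.Ioc (0 : ℝ) 1) ×ˢ (Set.Ioc (2 : ℝ) 3 ×ˢ Set.Ioc (0 : ℝ) 1)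
  have hG₁ : MeasurableSet G₁ := by measurability
  have hG₂ : MeasurableSet G₂ := by measurability
  have hpos : 0 < P.real G₁ * P.real G₂ := mul_pos
    (noiseLaw_real_prod_Ioc_pos hμ hν hσ hτ le_rfl one_pos le_rfl one_pos)
    (noiseLaw_real_prod_Ioc_pos hμ hν hσ hτ zero_le_two (by norm_num) le_rfl one_pos)
  have hle : P.real G₁ * P.real G₂ ≤ 1 :=
    mul_le_one₀ measureReal_le_one measureReal_nonneg measureReal_le_one
  refine ⟨1 - P.real G₁ * P.real G₂, sub_nonneg.2 hle, sub_lt_self _ hpos,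
    fun {f K} hf hK d d' => ?_⟩
  have hnear (d d' : ℝ) (hd : |d| ≤ 1) (hd' : |d'| ≤ 1) :
      |transition μ ν σ τ f d - transition μ ν σ τ f d'| ≤ K - (K - 0) * P.real G₂ := by
    refine abs_integral_sub_integral_le (hK.integrable_comp hf (measurable_nextDiff d) P)
      (hK.integrable_comp hf (measurable_nextDiff d') P) hG₂ (fun _ => hK _ _) fun a ha => ?_
    rw [nextDiff_eq_sub_fst ha hd, nextDiff_eq_sub_fst ha hd', sub_self, abs_zero]
  have hK' := hK.transition hμ hν hσ hτ hf
  have hf' := measurable_transition μ ν σ τ hf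
  calc _ ≤ K - (K - (K - (K - 0) * P.real G₂)) * P.real G₁ :=
        abs_integral_sub_integral_le (hK'.integrable_comp hf' (measurable_nextDiff d) P)
          (hK'.integrable_comp hf' (measurable_nextDiff d') P) hG₁ (fun _ => hK' _ _)
          fun a ha => hnear _ _ (abs_nextDiff_le_one ha d) (abs_nextDiff_le_one ha d')
    _ = (1 - P.real G₁ * P.real G₂) * K := by ring

lemma eq_of_transition_eq_sub_const {f : ℝ → ℝ} (hf : Measurable f) {K l : ℝ} (hK : OscLE f K)
    (h : ∀ d, transition μ ν σ τ f d = f d - l) (d d' : ℝ) : f d = f d' := by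
  have := isProbabilityMeasure_noiseLaw hμ hν hσ hτ
  obtain ⟨θ, hθ₀, hθ₁, hθ⟩ := exists_oscLE_transition_transition hμ hν hσ hτ
  have htwo (d : ℝ) : transition μ ν σ τ (transition μ ν σ τ f) d = f d - l - l := by
    rw [funext h, transition, integral_sub (hK.integrable_comp hf (measurable_nextDiff d) _)
      (integrable_const l), integral_const, probReal_univ, one_smul]
    exact congrArg (· - l) (h d)
  have hosc (n : ℕ) : OscLE f (θ ^ n * K) := by
    induction n with
    | zero => rwa [pow_zero, one_mul]
    | succ n ih =>
      intro d d'
      have hstep := hθ hf ih d d'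
      rwa [htwo, htwo, sub_sub_sub_cancel_right, sub_sub_sub_cancel_right, ← mul_assoc,
        ← pow_succ'] at hstep
  have hlim : Tendsto (fun n : ℕ => θ ^ n * K) atTop (𝓝 0) := by
    simpa only [zero_mul] using (tendsto_pow_atTop_nhds_zero_of_lt_one hθ₀ hθ₁).mul_const K
  exact sub_eq_zero.1 <| abs_nonpos_iff.1 <| ge_of_tendsto' hlim fun n => hosc n d d'

end

/-! ### The linear system -/

section Bordered

variable {n 𝕜 : Type*} [Fintype n] [Field 𝕜] {M : Matrix n n 𝕜} {e m : n → 𝕜}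

lemma vecMul_add_vecMulVec (c : n → 𝕜) :
    c ᵥ* (M + Matrix.vecMulVec e m) = c ᵥ* M + (c ⬝ᵥ e) • m := by
  rw [Matrix.vecMul_add, Matrix.vecMul_vecMulVec]

lemma add_vecMulVec_mulVec_eq_iff (hm : m ᵥ* M = 0) (he : m ⬝ᵥ e = 1) {x : n → 𝕜} :
    (M + Matrix.vecMulVec e m) *ᵥ x = e ↔ M *ᵥ x = 0 ∧ m ⬝ᵥ x = 1 := by
  have hmul : (M + Matrix.vecMulVec e m) *ᵥ x = M *ᵥ x + (m ⬝ᵥ x) • e := by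
    rw [Matrix.add_mulVec, Matrix.vecMulVec_mulVec, op_smul_eq_smul]
  rw [hmul]
  constructor
  · intro h
    have hx : m ⬝ᵥ x = 1 := by
      have := congrArg (m ⬝ᵥ ·) h
      simpa [dotProduct_add, Matrix.dotProduct_mulVec, hm, he] using this
    rw [hx, one_smul, add_eq_right] at h
    exact ⟨h, hx⟩
  · rintro ⟨h, hx⟩
    rw [h, hx, zero_add, one_smul]

lemma isUnit_add_vecMulVec [DecidableEq n] (hm : m ᵥ* M = 0) (he : m ⬝ᵥ e = 1)
    (hM : ∀ (c : n → 𝕜) (l : 𝕜), c ᵥ* M = l • m → ∃ k : 𝕜, c = k • m) :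
    IsUnit (M + Matrix.vecMulVec e m) := by
  rw [Matrix.isUnit_iff_isUnit_det, isUnit_iff_ne_zero]
  intro hdet
  obtain ⟨c, hc₀, hc⟩ := Matrix.exists_vecMul_eq_zero_iff.2 hdet
  rw [vecMul_add_vecMulVec] at hc
  obtain ⟨k, rfl⟩ := hM c (-(c ⬝ᵥ e)) (by rw [neg_smul]; exact eq_neg_of_add_eq_zero_left hc)
  rw [Matrix.smul_vecMul, hm, smul_zero, zero_add, smul_dotProduct, he, smul_eq_mul, mul_one] at hc
  exact hc₀ hc

lemma exists_dotProduct_eq_one (hm₀ : m ≠ 0) : ∃ e, m ⬝ᵥ e = 1 := by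
  classical
  obtain ⟨i, hi⟩ := Function.ne_iff.1 hm₀
  exact ⟨Pi.single i (m i)⁻¹, by rw [dotProduct_single, mul_inv_cancel₀ hi]⟩

variable (hm₀ : m ≠ 0) (hm : m ᵥ* M = 0)
  (hM : ∀ (c : n → 𝕜) (l : 𝕜), c ᵥ* M = l • m → ∃ k : 𝕜, c = k • m)
include hm₀ hm hM

lemma existsUnique_mulVec_eq_zero : ∃! x, M *ᵥ x = 0 ∧ m ⬝ᵥ x = 1 := by
  classical
  obtain ⟨e, he⟩ := exists_dotProduct_eq_one hm₀
  have hN := isUnit_add_vecMulVec hm he hM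
  simp only [← add_vecMulVec_mulVec_eq_iff hm he]
  exact Function.Bijective.existsUnique
    ⟨Matrix.mulVec_injective_of_isUnit hN, Matrix.mulVec_surjective_iff_isUnit.2 hN⟩ e

lemma exists_vecMul_eq_sub_smul {x : n → 𝕜} (hx : M *ᵥ x = 0) (hx₁ : m ⬝ᵥ x = 1) (q : n → 𝕜) :
    ∃ c, c ᵥ* M = q - (q ⬝ᵥ x) • m := by
  classical
  obtain ⟨e, he⟩ := exists_dotProduct_eq_one hm₀
  obtain ⟨c, hc : c ᵥ* (M + Matrix.vecMulVec e m) = q⟩ :=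
    Matrix.vecMul_surjective_iff_isUnit.2 (isUnit_add_vecMulVec hm he hM) q
  refine ⟨c, ?_⟩
  rw [← hc, ← Matrix.dotProduct_mulVec, (add_vecMulVec_mulVec_eq_iff hm he).2 ⟨hx, hx₁⟩,
    vecMul_add_vecMulVec, add_sub_cancel_right]

end Bordered

/-- The coefficients of the constant function `1` in the basis `expBasis`. -/
def oneCoeff : Fin 4 ⊕ Fin 4 → ℝ := Sum.elim (Pi.single 0 1) (Pi.single 0 1)

lemma oneCoeff_dotProduct (x : Fin 4 ⊕ Fin 4 → ℝ) :
    oneCoeff ⬝ᵥ x = x (Sum.inl 0) + x (Sum.inr 0) := by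
  rw [← Sum.elim_comp_inl_inr x, oneCoeff, sumElim_dotProduct_sumElim, single_one_dotProduct,
    single_one_dotProduct]
  rfl

lemma oneCoeff_dotProduct_expBasis (μ ν σ τ d : ℝ) : oneCoeff ⬝ᵥ expBasis μ ν σ τ d = 1 := by
  rw [oneCoeff_dotProduct]
  rcases le_or_gt d 0 with hd | hd
  · simp [expBasis_of_nonpos hd]
  · simp [expBasis_of_pos hd]

lemma oneCoeff_ne_zero : oneCoeff ≠ 0 := fun h => by
  simpa [h] using oneCoeff_dotProduct_expBasis 0 0 0 0 0

lemma isSolution_iff {μ ν σ τ : ℝ} {ω : Fin 4 ⊕ Fin 4 → ℝ} :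
    IsSolution μ ν σ τ ω ↔ (1 - W μ ν σ τ) *ᵥ ω = 0 ∧ oneCoeff ⬝ᵥ ω = 1 := by
  rw [oneCoeff_dotProduct, IsSolution]

lemma measurable_dotProduct_expBasis (μ ν σ τ : ℝ) (c : Fin 4 ⊕ Fin 4 → ℝ) :
    Measurable (fun d => c ⬝ᵥ expBasis μ ν σ τ d) :=
  Finset.measurable_sum _ fun i _ => (measurable_expBasis μ ν σ τ i).const_mul (c i)

section

variable {μ ν σ τ : ℝ} (hμ : 0 < μ) (hν : 0 < ν) (hσ : 0 < σ) (hτ : 0 < τ)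
include hμ hν hσ hτ

lemma abs_dotProduct_expBasis_le (c : Fin 4 ⊕ Fin 4 → ℝ) (d : ℝ) :
    |c ⬝ᵥ expBasis μ ν σ τ d| ≤ ∑ i, |c i| := by
  refine (Finset.abs_sum_le_sum_abs _ _).trans (Finset.sum_le_sum fun i _ => ?_)
  rw [abs_mul]
  exact mul_le_of_le_one_right (abs_nonneg _) (abs_expBasis_le_one hμ hν hσ hτ d i)

lemma oscLE_dotProduct_expBasis (c : Fin 4 ⊕ Fin 4 → ℝ) :
    OscLE (fun d => c ⬝ᵥ expBasis μ ν σ τ d) (∑ i, |c i| + ∑ i, |c i|) := fun d d' =>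
  (abs_sub _ _).trans (add_le_add (abs_dotProduct_expBasis_le hμ hν hσ hτ c d)
    (abs_dotProduct_expBasis_le hμ hν hσ hτ c d'))

lemma oneCoeff_vecMul_U : oneCoeff ᵥ* U μ ν σ τ = 1 := by
  have hprob {a b : ℝ} (ha : 0 < a) (hb : 0 < b) (j : Fin 3) :=
    isProbabilityMeasure_expMeasure (vecCons_add_pos ha hb j)
  rw [← halfLineIntegrals_dotProduct_expBasis hμ hν hσ hτ]
  ext (j | j)
  · have := hprob hμ hν j
    simp [halfLineIntegrals, oneCoeff_dotProduct_expBasis]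
  · have := hprob hσ hτ j
    simp [halfLineIntegrals, oneCoeff_dotProduct_expBasis]

lemma one_vecMul_V : 1 ᵥ* V μ ν σ τ = oneCoeff := by
  ext (j | j) <;> fin_cases j <;>
    simp [V, V₁₁, V₁₂, V₂₁, V₂₂, oneCoeff, Matrix.vecMul, dotProduct, Fin.sum_univ_three] <;>
    field_simp <;> ring

lemma oneCoeff_vecMul_W : oneCoeff ᵥ* W μ ν σ τ = oneCoeff := by
  rw [← U_mul_V, ← Matrix.vecMul_vecMul, oneCoeff_vecMul_U hμ hν hσ hτ,
    one_vecMul_V hμ hν hσ hτ]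

lemma exists_eq_smul_oneCoeff {c : Fin 4 ⊕ Fin 4 → ℝ} {l : ℝ}
    (hc : c ᵥ* (1 - W μ ν σ τ) = l • oneCoeff) : ∃ k : ℝ, c = k • oneCoeff := by
  rw [Matrix.vecMul_sub, Matrix.vecMul_one] at hc
  have htransition (d : ℝ) : transition μ ν σ τ (fun d => c ⬝ᵥ expBasis μ ν σ τ d) d =
      c ⬝ᵥ expBasis μ ν σ τ d - l := by
    rw [transition_dotProduct_expBasis hμ hν hσ hτ, ← sub_sub_cancel c (c ᵥ* _), hc,
      sub_dotProduct, smul_dotProduct, oneCoeff_dotProduct_expBasis, smul_eq_mul, mul_one]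
  have hconst := eq_of_transition_eq_sub_const hμ hν hσ hτ
    (measurable_dotProduct_expBasis μ ν σ τ c) (oscLE_dotProduct_expBasis hμ hν hσ hτ c) htransition
  set k := c ⬝ᵥ expBasis μ ν σ τ 0
  -- `expBasis` is linearly dependent for some rates, so `c` is recovered only through `U`.
  have hU : c ᵥ* U μ ν σ τ = (k • oneCoeff) ᵥ* U μ ν σ τ := by
    simp only [← halfLineIntegrals_dotProduct_expBasis hμ hν hσ hτ, smul_dotProduct,
      oneCoeff_dotProduct_expBasis, hconst _ 0, smul_eq_mul, mul_one, k]
  have hW : c ᵥ* W μ ν σ τ = k • oneCoeff := by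
    rw [← U_mul_V, ← Matrix.vecMul_vecMul, hU, Matrix.vecMul_vecMul, U_mul_V, Matrix.smul_vecMul,
      oneCoeff_vecMul_W hμ hν hσ hτ]
  exact ⟨l + k, by rw [add_smul, ← hc, hW, sub_add_cancel]⟩

lemma oneCoeff_vecMul_one_sub_W : oneCoeff ᵥ* (1 - W μ ν σ τ) = 0 := by
  rw [Matrix.vecMul_sub, Matrix.vecMul_one, oneCoeff_vecMul_W hμ hν hσ hτ, sub_self]

lemma existsUnique_isSolution : ∃! ω, IsSolution μ ν σ τ ω := by
  simp only [isSolution_iff]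
  exact existsUnique_mulVec_eq_zero oneCoeff_ne_zero (oneCoeff_vecMul_one_sub_W hμ hν hσ hτ)
    fun _ _ => exists_eq_smul_oneCoeff hμ hν hσ hτ

lemma exists_vecMul_one_sub_W_eq {ω : Fin 4 ⊕ Fin 4 → ℝ} (hω : IsSolution μ ν σ τ ω)
    (q : Fin 4 ⊕ Fin 4 → ℝ) : ∃ c, c ᵥ* (1 - W μ ν σ τ) = q - (q ⬝ᵥ ω) • oneCoeff :=
  have hω := isSolution_iff.1 hω
  exists_vecMul_eq_sub_smul oneCoeff_ne_zero (oneCoeff_vecMul_one_sub_W hμ hν hσ hτ)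
    (fun _ _ => exists_eq_smul_oneCoeff hμ hν hσ hτ) hω.1 hω.2 q

end

/-! ### A law of large numbers from second moments along the squares -/

lemma ae_tendsto_zero_of_tsum_lintegral_sq_ne_top {Ω : Type*} [MeasurableSpace Ω] {P : Measure Ω}
    {X : ℕ → Ω → ℝ} (hX : ∀ n, AEMeasurable (X n) P)
    (hsum : ∑' n, ∫⁻ s, ENNReal.ofReal (X n s ^ 2) ∂P ≠ ⊤) :
    ∀ᵐ s ∂P, Tendsto (fun n => X n s) atTop (𝓝 0) := by
  have hX₂ (n : ℕ) : AEMeasurable (fun s => ENNReal.ofReal (X n s ^ 2)) P :=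
    ((hX n).pow_const 2).ennreal_ofReal
  rw [← lintegral_tsum hX₂] at hsum
  filter_upwards [ae_lt_top' (AEMeasurable.tsum hX₂) hsum] with s hs
  have hsq : Tendsto (fun n => X n s ^ 2) atTop (𝓝 0) := by
    have h := (ENNReal.tendsto_toReal ENNReal.zero_ne_top).comp
      (ENNReal.tendsto_atTop_zero_of_tsum_ne_top hs.ne)
    exact h.congr fun n => ENNReal.toReal_ofReal (sq_nonneg _)
  have habs := hsq.sqrt
  simp only [Real.sqrt_sq_eq_abs, Real.sqrt_zero] at habs
  exact (tendsto_zero_iff_abs_tendsto_zero _).2 habs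

lemma ae_tendsto_div_sq_of_lintegral_sq_le {Ω : Type*} [MeasurableSpace Ω] {P : Measure Ω}
    {Y : ℕ → Ω → ℝ} (hY : ∀ n, AEMeasurable (Y n) P) {K : ℝ}
    (hK : ∀ n : ℕ, ∫⁻ s, ENNReal.ofReal (Y n s ^ 2) ∂P ≤ n * ENNReal.ofReal K) :
    ∀ᵐ s ∂P, Tendsto (fun n : ℕ => Y ((n + 1) ^ 2) s / ((n + 1) ^ 2 : ℕ)) atTop (𝓝 0) := by
  refine ae_tendsto_zero_of_tsum_lintegral_sq_ne_top (fun n => (hY _).div_const _) ?_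
  have hbound (n : ℕ) : ∫⁻ s, ENNReal.ofReal ((Y ((n + 1) ^ 2) s / ((n + 1) ^ 2 : ℕ)) ^ 2) ∂P ≤
      ENNReal.ofReal (1 / ((n + 1 : ℕ) : ℝ) ^ 2 * K) := by
    calc ∫⁻ s, ENNReal.ofReal ((Y ((n + 1) ^ 2) s / ((n + 1) ^ 2 : ℕ)) ^ 2) ∂P
        = ENNReal.ofReal (1 / (((n + 1) ^ 2 : ℕ) : ℝ) ^ 2) *
            ∫⁻ s, ENNReal.ofReal (Y ((n + 1) ^ 2) s ^ 2) ∂P := by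
          rw [← lintegral_const_mul' _ _ ENNReal.ofReal_ne_top]
          refine lintegral_congr fun s => ?_
          rw [← ENNReal.ofReal_mul (by positivity), div_pow, one_div_mul_eq_div]
      _ ≤ ENNReal.ofReal (1 / (((n + 1) ^ 2 : ℕ) : ℝ) ^ 2) *
            (((n + 1) ^ 2 : ℕ) * ENNReal.ofReal K) := by gcongr; exact hK _
      _ = ENNReal.ofReal (1 / ((n + 1 : ℕ) : ℝ) ^ 2 * K) := by
          rw [← ENNReal.ofReal_natCast, ← mul_assoc, ← ENNReal.ofReal_mul (by positivity),
            ← ENNReal.ofReal_mul (by positivity)]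
          congr 2
          push_cast
          field_simp
  refine ne_top_of_le_ne_top ?_ (ENNReal.tsum_le_tsum hbound)
  refine Summable.tsum_ofReal_ne_top (Summable.mul_right K ?_)
  exact (summable_nat_add_iff 1).2 (Real.summable_one_div_nat_pow.2 one_lt_two)

lemma tendsto_div_of_monotone_of_tendsto_sq {u : ℕ → ℝ} {l : ℝ} (hu : Monotone u)
    (h : Tendsto (fun n : ℕ => u ((n + 1) ^ 2) / ((n + 1) ^ 2 : ℕ)) atTop (𝓝 l)) :
    Tendsto (fun n : ℕ => u n / n) atTop (𝓝 l) := by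
  refine tendsto_div_of_monotone_of_exists_subseq_tendsto_div u l hu fun a ha =>
    ⟨fun n => (n + 1) ^ 2, ?_, ?_, h⟩
  · have hratio : Tendsto (fun n : ℕ => (1 + 1 / ((n : ℝ) + 1)) ^ 2) atTop (𝓝 1) := by
      simpa only [add_zero, one_pow] using
        ((tendsto_one_div_add_atTop_nhds_zero_nat (𝕜 := ℝ)).const_add 1).pow 2
    filter_upwards [hratio.eventually_le_const ha] with n hn
    calc (((n + 1 + 1) ^ 2 : ℕ) : ℝ)
        = (1 + 1 / ((n : ℝ) + 1)) ^ 2 * ((n + 1) ^ 2 : ℕ) := by push_cast; field_simp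
      _ ≤ a * ((n + 1) ^ 2 : ℕ) := by gcongr
  · exact (tendsto_pow_atTop two_ne_zero).comp (tendsto_add_atTop_nat 1)

lemma lintegral_sq_const_add_le {α : Type*} [MeasurableSpace α] {m : Measure α}
    [IsProbabilityMeasure m] {ξ S : α → ℝ} (hξ : AEStronglyMeasurable ξ m) (hS : MemLp S 2 m)
    (hle : ∀ a, |ξ a| ≤ S a) (hmean : ∫ a, ξ a ∂m = 0) (y : ℝ) :
    ∫⁻ a, ENNReal.ofReal ((y + ξ a) ^ 2) ∂m ≤
      ENNReal.ofReal (y ^ 2) + ENNReal.ofReal (∫ a, S a ^ 2 ∂m) := by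
  have hξ₂ : MemLp ξ 2 m := hS.mono' hξ (Eventually.of_forall hle)
  have hcross : Integrable (fun a => 2 * y * ξ a) m := (hξ₂.integrable one_le_two).const_mul _
  have hlin : Integrable (fun a => y ^ 2 + 2 * y * ξ a) m := (integrable_const _).add hcross
  have hsum : MemLp (fun a => y + ξ a) 2 m := (memLp_const y).add hξ₂
  rw [← ofReal_integral_eq_lintegral_ofReal hsum.integrable_sq
      (Eventually.of_forall fun a => sq_nonneg _),
    ← ENNReal.ofReal_add (sq_nonneg _) (integral_nonneg fun a => sq_nonneg _)]
  refine ENNReal.ofReal_le_ofReal ?_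
  calc ∫ a, (y + ξ a) ^ 2 ∂m = ∫ a, (y ^ 2 + 2 * y * ξ a + ξ a ^ 2) ∂m :=
        integral_congr_ae (Eventually.of_forall fun a => add_sq y (ξ a))
    _ = y ^ 2 + ∫ a, ξ a ^ 2 ∂m := by
        rw [integral_add hlin hξ₂.integrable_sq,
          integral_add (integrable_const _) hcross, integral_const_mul, hmean, integral_const,
          probReal_univ, one_smul, mul_zero, add_zero]
    _ ≤ y ^ 2 + ∫ a, S a ^ 2 ∂m :=
        add_le_add le_rfl (integral_mono hξ₂.integrable_sq hS.integrable_sq fun a =>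
          sq_le_sq.2 ((hle a).trans (le_abs_self _)))

/-! ### The trajectory as a random process -/

/-- The entries of a matrix, as a pair of rows. -/
def entries (M : Matrix (Fin 2) (Fin 2) ℝ) : (ℝ × ℝ) × (ℝ × ℝ) :=
  ((M 0 0, M 0 1), (M 1 0, M 1 1))

/-- One step of the recursion, driven by the entries `a` of the matrix. -/
def step (z : Fin 2 → ℝ) (a : (ℝ × ℝ) × (ℝ × ℝ)) : Fin 2 → ℝ :=
  ![max (z 0) (z 1) + rowMax (z 1 - z 0) a.1, max (z 0) (z 1) + rowMax (z 1 - z 0) a.2]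

lemma max_add_rowMax (x y : ℝ) (p : ℝ × ℝ) :
    max x y + rowMax (y - x) p = max (x + p.1) (y + p.2) := by
  have hx : max x y = x + (y - x)⁺ := by rw [max_comm, ← sup_eq_add_posPart_sub]
  have hy : max x y = y + (y - x)⁻ := by linarith [posPart_sub_negPart (y - x)]
  rw [rowMax, ← max_add_add_left]
  congr 1 <;> linarith

lemma mulVec_eq_step (M : Matrix (Fin 2) (Fin 2) ℝ) (z : Fin 2 → ℝ) :
    mulVec M z = step z (entries M) := by
  ext i
  fin_cases i
  · exact (max_add_rowMax (z 0) (z 1) (M 0 0, M 0 1)).symm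
  · exact (max_add_rowMax (z 0) (z 1) (M 1 0, M 1 1)).symm

lemma max_step (z : Fin 2 → ℝ) (a : (ℝ × ℝ) × (ℝ × ℝ)) :
    max (step z a 0) (step z a 1) = max (z 0) (z 1) + maxIncr (z 1 - z 0) a :=
  max_add_add_left _ _ _

lemma step_one_sub_step_zero (z : Fin 2 → ℝ) (a : (ℝ × ℝ) × (ℝ × ℝ)) :
    step z a 1 - step z a 0 = nextDiff (z 1 - z 0) a :=
  add_sub_add_left_eq_sub _ _ _

lemma measurable_uncurry_step : Measurable (Function.uncurry step) := by
  refine measurable_pi_iff.2 fun i => ?_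
  fin_cases i <;> simp only [Function.uncurry, step, max_add_rowMax] <;>
    exact Measurable.max (by fun_prop) (by fun_prop)

lemma measurable_state {α : Type*} [MeasurableSpace α] {B : ℕ+ → α → Matrix (Fin 2) (Fin 2) ℝ}
    (hB : ∀ k i j, Measurable fun a => B k a i j) (n : ℕ) :
    Measurable fun a => state (fun k => B k a) n := by
  induction n with
  | zero => exact measurable_const
  | succ n ih =>
    refine measurable_pi_iff.2 fun i => ?_
    exact (((measurable_pi_apply 0).comp ih).add (hB n.succPNat i 0)).max
      (((measurable_pi_apply 1).comp ih).add (hB n.succPNat i 1))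

lemma state_congr {A A' : ℕ+ → Matrix (Fin 2) (Fin 2) ℝ} {n : ℕ}
    (h : ∀ m < n, A m.succPNat = A' m.succPNat) : state A n = state A' n := by
  induction n with
  | zero => rfl
  | succ n ih =>
    rw [state, state, h n n.lt_succ_self, ih fun m hm => h m (hm.trans n.lt_succ_self)]

lemma monotone_max_state {A : ℕ+ → Matrix (Fin 2) (Fin 2) ℝ} (hA : ∀ k i, 0 ≤ A k i i) :
    Monotone fun k => max (state A k 0) (state A k 1) := by
  refine monotone_nat_of_le_succ fun n => max_le_max ?_ ?_
  · exact le_max_of_le_left (le_add_of_nonneg_right (hA n.succPNat 0))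
  · exact le_max_of_le_right (le_add_of_nonneg_right (hA n.succPNat 1))

namespace IsExponentialSystem

variable {Ω : Type*} [MeasurableSpace Ω] {P : Measure Ω}
  {A : ℕ+ → Ω → Matrix (Fin 2) (Fin 2) ℝ} {μ ν σ τ : ℝ} (hA : IsExponentialSystem P A μ ν σ τ)
include hA

lemma aemeasurable (p : ℕ+ × Fin 2 × Fin 2) : AEMeasurable (fun s => A p.1 s p.2.1 p.2.2) P := by
  obtain ⟨k, i, j⟩ := p
  fin_cases i <;> fin_cases j
  · exact (hA.law_alpha k).aemeasurable
  · exact (hA.law_beta k).aemeasurable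
  · exact (hA.law_gamma k).aemeasurable
  · exact (hA.law_delta k).aemeasurable

lemma aemeasurable_state (n : ℕ) : AEMeasurable (fun s => state (fun k => A k s) n) P := by
  refine ⟨fun s => state (fun k => Matrix.of fun i j => (hA.aemeasurable (k, i, j)).mk _ s) n,
    measurable_state (fun k i j => (hA.aemeasurable (k, i, j)).measurable_mk) n, ?_⟩
  filter_upwards [ae_all_iff.2 fun p => (hA.aemeasurable p).ae_eq_mk] with s hs
  exact state_congr fun m _ => Matrix.ext fun i j => hs (m.succPNat, i, j)

lemma ae_nonneg_diag : ∀ᵐ s ∂P, ∀ k i, 0 ≤ A k s i i := by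
  have hpos {X : Ω → ℝ} {r : ℝ} (hX : HasLaw X (expMeasure r) P) : ∀ᵐ s ∂P, 0 ≤ X s :=
    (hX.ae_iff (measurableSet_setOfPred.1 measurableSet_Ici)).2
      ((ae_pos_expMeasure r).mono fun _ => le_of_lt)
  refine ae_all_iff.2 fun k => ae_all_iff.2 fun i => ?_
  fin_cases i
  · exact hpos (hA.law_alpha k)
  · exact hpos (hA.law_delta k)

lemma indepFun_state_entries (n : ℕ) :
    IndepFun (fun s => state (fun k => A k s) n) (fun s => entries (A n.succPNat s)) P := by
  classical
  let past : Finset (ℕ+ × Fin 2 × Fin 2) := (Finset.range n).image Nat.succPNat ×ˢ Finset.univ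
  let present : Finset (ℕ+ × Fin 2 × Fin 2) := {n.succPNat} ×ˢ Finset.univ
  have hpast {k : ℕ+} (i j : Fin 2) : (k, i, j) ∈ past ↔ ∃ m < n, m.succPNat = k := by
    simp [past]
  have hpresent (i j : Fin 2) : (n.succPNat, i, j) ∈ present := by simp [present]
  have hdisjoint : Disjoint past present := by
    rw [Finset.disjoint_left]
    rintro ⟨k, i, j⟩ hk hk'
    obtain ⟨m, hm, rfl⟩ := (hpast i j).1 hk
    have heq : n = m := by simpa [present] using hk'
    exact hm.ne' heq
  have hstate : Measurable fun v : past → ℝ => state (fun k => Matrix.of fun i j =>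
      if h : (k, i, j) ∈ past then v ⟨(k, i, j), h⟩ else 0) n := by
    refine measurable_state (fun k i j => ?_) n
    by_cases hk : (k, i, j) ∈ past <;> simp only [Matrix.of_apply, hk, ↓reduceDIte] <;> fun_prop
  have hentries : Measurable fun v : present → ℝ =>
      ((v ⟨_, hpresent 0 0⟩, v ⟨_, hpresent 0 1⟩), (v ⟨_, hpresent 1 0⟩, v ⟨_, hpresent 1 1⟩)) := by
    fun_prop
  convert! (hA.indep.indepFun_finset₀ past present hdisjoint hA.aemeasurable).comp hstate hentries
    using 1
  ext1 s
  refine state_congr fun m hm => Matrix.ext fun i j => ?_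
  simp only [Matrix.of_apply, (hpast i j).2 ⟨m, hm, rfl⟩, ↓reduceDIte]

variable [IsProbabilityMeasure P]

lemma hasLaw_entries (k : ℕ+) : HasLaw (fun s => entries (A k s)) (noiseLaw μ ν σ τ) P := by
  have hrow (i : Fin 2) : IndepFun (fun s => A k s i 0) (fun s => A k s i 1) P :=
    hA.indep.indepFun (i := (k, i, 0)) (j := (k, i, 1)) (by simp)
  have hrows := hA.indep.indepFun_prodMk_prodMk₀ hA.aemeasurable (k, 0, 0) (k, 0, 1) (k, 1, 0)
    (k, 1, 1) (by simp) (by simp) (by simp) (by simp)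
  exact (indepFun_iff_hasLaw_prodMk_prod
    ((indepFun_iff_hasLaw_prodMk_prod (hA.law_alpha k) (hA.law_beta k)).1 (hrow 0))
    ((indepFun_iff_hasLaw_prodMk_prod (hA.law_gamma k) (hA.law_delta k)).1 (hrow 1))).1 hrows

lemma lintegral_state_succ (n : ℕ) {F : (Fin 2 → ℝ) → ENNReal} (hF : Measurable F) :
    ∫⁻ s, F (state (fun k => A k s) (n + 1)) ∂P =
      ∫⁻ s, ∫⁻ a, F (step (state (fun k => A k s) n) a) ∂noiseLaw μ ν σ τ ∂P := by
  have hstate := hA.aemeasurable_state n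
  have hlaw := (indepFun_iff_hasLaw_prodMk_prod ⟨hstate, rfl⟩ (hA.hasLaw_entries n.succPNat)).1
    (hA.indepFun_state_entries n)
  have hFstep := hF.comp measurable_uncurry_step
  calc ∫⁻ s, F (state (fun k => A k s) (n + 1)) ∂P
      = ∫⁻ s, F (step (state (fun k => A k s) n) (entries (A n.succPNat s))) ∂P := by
        simp only [state, mulVec_eq_step]
    _ = ∫⁻ p, F (step p.1 p.2) ∂(P.map fun s => state (fun k => A k s) n).prod
          (noiseLaw μ ν σ τ) := hlaw.lintegral_comp hFstep.aemeasurable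
    _ = ∫⁻ z, ∫⁻ a, F (step z a) ∂noiseLaw μ ν σ τ ∂P.map fun s => state (fun k => A k s) n :=
        lintegral_prod _ hFstep.aemeasurable
    _ = ∫⁻ s, ∫⁻ a, F (step (state (fun k => A k s) n) a) ∂noiseLaw μ ν σ τ ∂P :=
        lintegral_map' hFstep.lintegral_prod_right'.aemeasurable hstate

end IsExponentialSystem

/-! ### The limit -/

lemma measurable_maxIncr (d : ℝ) : Measurable (maxIncr d) :=
  ((measurable_rowMax d).comp measurable_fst).max ((measurable_rowMax d).comp measurable_snd)

/-- The sum of the absolute values of the entries of one matrix: a bound for the growth of the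
larger coordinate in one step, uniform in the state. -/
def noiseSize (a : (ℝ × ℝ) × (ℝ × ℝ)) : ℝ := (|a.1.1| + |a.1.2|) + (|a.2.1| + |a.2.2|)

lemma abs_rowMax_le (d : ℝ) (p : ℝ × ℝ) : |rowMax d p| ≤ |p.1| + |p.2| := by
  have h₁ := abs_le.1 (le_refl |p.1|)
  have h₂ := abs_le.1 (le_refl |p.2|)
  have hp := posPart_nonneg d
  have hn := negPart_nonneg d
  refine abs_le.2 ⟨?_, max_le (by linarith) (by linarith)⟩
  rcases le_total d 0 with hd | hd
  · refine le_max_of_le_left ?_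
    rw [posPart_of_nonpos hd]
    linarith
  · refine le_max_of_le_right ?_
    rw [negPart_of_nonneg hd]
    linarith

lemma abs_maxIncr_le_noiseSize (d : ℝ) (a : (ℝ × ℝ) × (ℝ × ℝ)) : |maxIncr d a| ≤ noiseSize a :=
  calc |maxIncr d a| ≤ max |rowMax d a.1| |rowMax d a.2| := abs_max_le_max_abs_abs
    _ ≤ |rowMax d a.1| + |rowMax d a.2| := max_le_add_of_nonneg (abs_nonneg _) (abs_nonneg _)
    _ ≤ noiseSize a := add_le_add (abs_rowMax_le d a.1) (abs_rowMax_le d a.2)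

/-- How far the larger coordinate, corrected by the function `f` of the difference of the
coordinates, is from growing by `l` per step after `n` steps. -/
def deviation (f : ℝ → ℝ) (l : ℝ) (n : ℕ) (z : Fin 2 → ℝ) : ℝ :=
  max (z 0) (z 1) + f (z 1 - z 0) - f 0 - n * l

/-- The increment of `deviation` in a step from a state with difference `d`. -/
def deviationIncr (f : ℝ → ℝ) (l d : ℝ) (a : (ℝ × ℝ) × (ℝ × ℝ)) : ℝ :=
  maxIncr d a + f (nextDiff d a) - f d - l

lemma deviation_zero (f : ℝ → ℝ) (l : ℝ) : deviation f l 0 0 = 0 := by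
  simp [deviation]

lemma deviation_step (f : ℝ → ℝ) (l : ℝ) (n : ℕ) (z : Fin 2 → ℝ) (a : (ℝ × ℝ) × (ℝ × ℝ)) :
    deviation f l (n + 1) (step z a) = deviation f l n z + deviationIncr f l (z 1 - z 0) a := by
  rw [deviation, deviation, deviationIncr, max_step, step_one_sub_step_zero]
  push_cast
  ring

lemma measurable_deviation {f : ℝ → ℝ} (hf : Measurable f) (l : ℝ) (n : ℕ) :
    Measurable (deviation f l n) := by
  unfold deviation
  fun_prop

lemma measurable_deviationIncr {f : ℝ → ℝ} (hf : Measurable f) (l d : ℝ) :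
    Measurable (deviationIncr f l d) :=
  (((measurable_maxIncr d).add (hf.comp (measurable_nextDiff d))).sub_const _).sub_const _

lemma OscLE.abs_deviationIncr_le {f : ℝ → ℝ} {K : ℝ} (hK : OscLE f K) (l d : ℝ)
    (a : (ℝ × ℝ) × (ℝ × ℝ)) : |deviationIncr f l d a| ≤ noiseSize a + (K + |l|) :=
  calc |deviationIncr f l d a| = |maxIncr d a + (f (nextDiff d a) - f d - l)| := by
        rw [deviationIncr]; ring_nf
    _ ≤ |maxIncr d a| + (|f (nextDiff d a) - f d| + |l|) :=
        (abs_add_le _ _).trans (add_le_add le_rfl (abs_sub _ _))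
    _ ≤ noiseSize a + (K + |l|) := by
        gcongr
        · exact abs_maxIncr_le_noiseSize d a
        · exact hK _ _

section NoiseLaw

variable {μ ν σ τ : ℝ} (hμ : 0 < μ) (hν : 0 < ν) (hσ : 0 < σ) (hτ : 0 < τ)
include hμ hν hσ hτ

lemma memLp_noiseSize : MemLp noiseSize 2 (noiseLaw μ ν σ τ) := by
  have := isProbabilityMeasure_expMeasure hμ
  have := isProbabilityMeasure_expMeasure hν
  have := isProbabilityMeasure_expMeasure hσ
  have := isProbabilityMeasure_expMeasure hτ
  have habs {r : ℝ} (hr : 0 < r) : MemLp (fun t : ℝ => |t|) 2 (expMeasure r) :=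
    ((memLp_two_iff_integrable_sq measurable_id.aestronglyMeasurable).2
      (integrable_pow_expMeasure hr 2)).abs
  exact ((((habs hμ).comp_fst _).add ((habs hν).comp_snd _)).comp_fst _).add
    ((((habs hσ).comp_fst _).add ((habs hτ).comp_snd _)).comp_snd _)

lemma integral_maxIncr_add_transition {c : Fin 4 ⊕ Fin 4 → ℝ} {l : ℝ}
    (hc : c ᵥ* (1 - W μ ν σ τ) = Sum.elim (q₁ μ ν σ τ) (q₂ μ ν σ τ) - l • oneCoeff) (d : ℝ) :
    ∫ a, maxIncr d a ∂noiseLaw μ ν σ τ + transition μ ν σ τ (fun d => c ⬝ᵥ expBasis μ ν σ τ d) d =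
      c ⬝ᵥ expBasis μ ν σ τ d + l := by
  have h := congrArg (· ⬝ᵥ expBasis μ ν σ τ d) hc
  simp only [Matrix.vecMul_sub, Matrix.vecMul_one, sub_dotProduct, smul_dotProduct,
    oneCoeff_dotProduct_expBasis, smul_eq_mul, mul_one] at h
  rw [integral_maxIncr hμ hν hσ hτ, transition_dotProduct_expBasis hμ hν hσ hτ]
  linarith

variable {f : ℝ → ℝ} (hf : Measurable f) {K : ℝ} (hK : OscLE f K) {l : ℝ}
  (hpoisson : ∀ d, ∫ a, maxIncr d a ∂noiseLaw μ ν σ τ + transition μ ν σ τ f d = f d + l)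
include hf hK hpoisson

lemma integral_deviationIncr (d : ℝ) : ∫ a, deviationIncr f l d a ∂noiseLaw μ ν σ τ = 0 := by
  have := isProbabilityMeasure_noiseLaw hμ hν hσ hτ
  have hmax : Integrable (maxIncr d) (noiseLaw μ ν σ τ) :=
    ((memLp_noiseSize hμ hν hσ hτ).integrable one_le_two).mono'
      (measurable_maxIncr d).aestronglyMeasurable
      (Eventually.of_forall (abs_maxIncr_le_noiseSize d))
  have hnext := hK.integrable_comp hf (measurable_nextDiff d) (noiseLaw μ ν σ τ)
  have hsum : Integrable (fun a => maxIncr d a + f (nextDiff d a)) (noiseLaw μ ν σ τ) :=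
    hmax.add hnext
  calc ∫ a, deviationIncr f l d a ∂noiseLaw μ ν σ τ
      = ∫ a, maxIncr d a + f (nextDiff d a) - (f d + l) ∂noiseLaw μ ν σ τ := by
        simp only [deviationIncr, sub_sub]
    _ = ∫ a, maxIncr d a ∂noiseLaw μ ν σ τ + transition μ ν σ τ f d - (f d + l) := by
        rw [integral_sub hsum (integrable_const _), integral_add hmax hnext, integral_const,
          probReal_univ, one_smul, transition]
    _ = 0 := sub_eq_zero.2 (hpoisson d)

namespace IsExponentialSystem

variable {Ω : Type*} [MeasurableSpace Ω] {P : Measure Ω} [IsProbabilityMeasure P]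
  {A : ℕ+ → Ω → Matrix (Fin 2) (Fin 2) ℝ} (hA : IsExponentialSystem P A μ ν σ τ)
include hA

lemma lintegral_deviation_sq_le (n : ℕ) :
    ∫⁻ s, ENNReal.ofReal (deviation f l n (state (fun k => A k s) n) ^ 2) ∂P ≤
      n * ENNReal.ofReal (∫ a, (noiseSize a + (K + |l|)) ^ 2 ∂noiseLaw μ ν σ τ) := by
  have := isProbabilityMeasure_noiseLaw hμ hν hσ hτ
  have hsize : MemLp (fun a => noiseSize a + (K + |l|)) 2 (noiseLaw μ ν σ τ) :=
    (memLp_noiseSize hμ hν hσ hτ).add (memLp_const _)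
  set M := ENNReal.ofReal (∫ a, (noiseSize a + (K + |l|)) ^ 2 ∂noiseLaw μ ν σ τ)
  induction n with
  | zero => simp [state, deviation_zero]
  | succ n ih =>
    calc ∫⁻ s, ENNReal.ofReal (deviation f l (n + 1) (state (fun k => A k s) (n + 1)) ^ 2) ∂P
        = ∫⁻ s, ∫⁻ a, ENNReal.ofReal
            (deviation f l (n + 1) (step (state (fun k => A k s) n) a) ^ 2)
              ∂noiseLaw μ ν σ τ ∂P :=
          hA.lintegral_state_succ n ((measurable_deviation hf l (n + 1)).pow_const 2).ennreal_ofReal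
      _ ≤ ∫⁻ s, (ENNReal.ofReal (deviation f l n (state (fun k => A k s) n) ^ 2) + M) ∂P := by
          refine lintegral_mono fun s => ?_
          simp only [deviation_step]
          exact lintegral_sq_const_add_le (measurable_deviationIncr hf l _).aestronglyMeasurable
            hsize (hK.abs_deviationIncr_le l _)
            (integral_deviationIncr hμ hν hσ hτ hf hK hpoisson _) _
      _ = ∫⁻ s, ENNReal.ofReal (deviation f l n (state (fun k => A k s) n) ^ 2) ∂P + M := by
          rw [lintegral_add_right _ measurable_const, lintegral_const, measure_univ, mul_one]
      _ ≤ n * M + M := by gcongr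
      _ = (n + 1 : ℕ) * M := by push_cast; ring

theorem isLyapunovExponent_of_poisson : IsLyapunovExponent P A l := by
  have hdeviation : ∀ᵐ s ∂P, Tendsto (fun n : ℕ =>
      deviation f l ((n + 1) ^ 2) (state (fun k => A k s) ((n + 1) ^ 2)) / ((n + 1) ^ 2 : ℕ))
      atTop (𝓝 0) :=
    ae_tendsto_div_sq_of_lintegral_sq_le (Y := fun n s => deviation f l n (state (A · s) n))
      (fun n => (measurable_deviation hf l n).comp_aemeasurable (hA.aemeasurable_state n))
      (hA.lintegral_deviation_sq_le hμ hν hσ hτ hf hK hpoisson)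
  filter_upwards [hdeviation, hA.ae_nonneg_diag] with s hs hdiag
  set z : ℕ → Fin 2 → ℝ := state fun k => A k s
  have hsq : Tendsto (fun n : ℕ => (((n + 1) ^ 2 : ℕ) : ℝ)) atTop atTop :=
    tendsto_natCast_atTop_atTop.comp
      ((tendsto_pow_atTop two_ne_zero).comp (tendsto_add_atTop_nat 1))
  have hcorrection : Tendsto (fun n : ℕ =>
      (f 0 - f (z ((n + 1) ^ 2) 1 - z ((n + 1) ^ 2) 0)) / ((n + 1) ^ 2 : ℕ)) atTop (𝓝 0) := by
    refine squeeze_zero_norm (fun n => ?_) (hsq.const_div_atTop K)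
    rw [norm_div, Real.norm_eq_abs, Real.norm_natCast]
    gcongr
    exact hK _ _
  have hmax : Tendsto (fun n : ℕ =>
      max (z ((n + 1) ^ 2) 0) (z ((n + 1) ^ 2) 1) / ((n + 1) ^ 2 : ℕ)) atTop (𝓝 l) := by
    have h := (hs.add hcorrection).add_const l
    rw [add_zero, zero_add] at h
    refine h.congr fun n => ?_
    have hn : (((n + 1) ^ 2 : ℕ) : ℝ) ≠ 0 := by positivity
    simp only [deviation]
    field_simp
    ring
  exact (tendsto_div_of_monotone_of_tendsto_sq (monotone_max_state hdiag) hmax).congr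
    fun n => (one_div_mul_eq_div _ _).symm

end IsExponentialSystem

end NoiseLaw

end

end MaxPlus

theorem mainTheorem1 {Ω : Type*} [MeasurableSpace Ω] (P : Measure Ω) [IsProbabilityMeasure P]
    (A : ℕ+ → Ω → Matrix (Fin 2) (Fin 2) ℝ) (μ ν σ τ : ℝ)
    (hμ : 0 < μ) (hν : 0 < ν) (hσ : 0 < σ) (hτ : 0 < τ)
    (hA : MaxPlus.IsExponentialSystem P A μ ν σ τ) :
    (∃! ω : Fin 4 ⊕ Fin 4 → ℝ, MaxPlus.IsSolution μ ν σ τ ω) ∧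
    ∀ ω : Fin 4 ⊕ Fin 4 → ℝ, MaxPlus.IsSolution μ ν σ τ ω →
      MaxPlus.IsLyapunovExponent P A
        (MaxPlus.q₁ μ ν σ τ ⬝ᵥ (fun i => ω (Sum.inl i)) +
          MaxPlus.q₂ μ ν σ τ ⬝ᵥ (fun i => ω (Sum.inr i))) := by
  refine ⟨MaxPlus.existsUnique_isSolution hμ hν hσ hτ, fun ω hω => ?_⟩
  obtain ⟨c, hc⟩ := MaxPlus.exists_vecMul_one_sub_W_eq hμ hν hσ hτ hω
    (Sum.elim (MaxPlus.q₁ μ ν σ τ) (MaxPlus.q₂ μ ν σ τ))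
  have hvalue : Sum.elim (MaxPlus.q₁ μ ν σ τ) (MaxPlus.q₂ μ ν σ τ) ⬝ᵥ ω =
      MaxPlus.q₁ μ ν σ τ ⬝ᵥ (fun i => ω (Sum.inl i)) +
        MaxPlus.q₂ μ ν σ τ ⬝ᵥ (fun i => ω (Sum.inr i)) := by
    simp [dotProduct, Fintype.sum_sum_type]
  rw [hvalue] at hc
  exact hA.isLyapunovExponent_of_poisson hμ hν hσ hτ
    (MaxPlus.measurable_dotProduct_expBasis μ ν σ τ c)
    (MaxPlus.oscLE_dotProduct_expBasis hμ hν hσ hτ c)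
    (MaxPlus.integral_maxIncr_add_transition hμ hν hσ hτ hc)
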